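/- Let $\mathcal I$ be a measurable space (of images), $n\ge 1$ (the number of pixels), and let $\mathcal D$ be a probability distribution of pairs $(I,\mathbf z)$ with $I\in\mathcal I$ and $\mathbf z\in\mathbb R^n_+$ (the dot annotation map of $I$; for instance $\mathbf z\in\{0,1\}^n$). Let $\mathcal H$ be a set of measurable functions $h:\mathcal I\to\mathbb R_+$ that is pointwise separable (it has a countable subset such that every $h\in\mathcal H$ is the pointwise limit of a sequence from it), and let $\mathcal F=\mathcal H^n$, so that each $f\in\mathcal F$ maps $\mathcal I$ to $\mathbb R^n_+$. Let $\mathbf C\in\mathbb R_+^{n\times n}$ be a cost matrix with largest entry $\mathbf C_\infty$, and let $\lambda_1,\lambda_2\ge 0$. For $\mathbf z,\hat{\mathbf z}\in\mathbb R^n_+\setminus\{0\}$ put $$\ell_C(\mathbf z,\hat{\mathbf z})=\bigl|\,\|\mathbf z\|_1-\|\hat{\mathbf z}\|_1\bigr|,\qquad \ell_{OT}(\mathbf z,\hat{\mathbf z})=\mathcal W\Bigl(\tfrac{\mathbf z}{\|\mathbf z\|_1},\tfrac{\hat{\mathbf z}}{\|\hat{\mathbf z}\|_1}\Bigr),\qquad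 \ell_{TV}(\mathbf z,\hat{\mathbf z})=\tfrac12\Bigl\|\tfrac{\mathbf z}{\|\mathbf z\|_1}-\tfrac{\hat{\mathbf z}}{\|\hat{\mathbf z}\|_1}\Bigr\|_1,$$ $$\ell=\ell_C+\lambda_1\ell_{OT}+\lambda_2\|\mathbf z\|_1\,\ell_{TV},$$ where $\mathcal W(\mu,\nu)=\min\{\sum_{i,j}\mathbf C_{ij}\gamma_{ij}:\gamma\in\mathbb R_+^{n\times n},\ \gamma\mathbf 1=\mu,\ \gamma^T\mathbf 1=\nu\}$ is the optimal transport cost. Let $S=\{(I_k,\mathbf z_k)\}_{k=1}^K$, $K\ge1$, be an i.i.d. sample from $\mathcal D$. For a loss $\ell_\Delta$, let $\mathcal R(\mathcal D,f,\ell_\Delta)=\mathbb E_{(I,\mathbf z)\sim\mathcal D}[\ell_\Delta(\mathbf z,f(I))]$ and $\mathcal R(S,f,\ell_\Delta)=\frac1K\sum_{k}\ell_\Delta(\mathbf z_k,f(I_k))$, and let $f_\Delta^{\mathcal D}$ and $f_\Delta^{S}$ denote minimizers over $f\in\mathcal F$ of $\mathcal R(\mathcal D,f,\ell_\Delta)$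 and of $\mathcal R(S,f,\ell_\Delta)$ (no subscript for the loss $\ell$). Let $R_S(\mathcal H)=\mathbb E_\sigma\bigl[\sup_{h\in\mathcal H}\frac1K\sum_k\sigma_kh(I_k)\bigr]$, with $\sigma_1,\dots,\sigma_K$ independent uniform random signs, be the empirical Rademacher complexity, and let $N$ be the (essential) supremum of $\|\mathbf z\|_1$ over $(I,\mathbf z)\sim\mathcal D$. Assume that, for every $f\in\mathcal F$ and almost all $(I,\mathbf z)\sim\mathcal D$, $\|\mathbf z\|_1\ge1$, $\|f(I)\|_1\ge1$ and $\ell_C(\mathbf z,f(I))\le B$. Then, for every $0<\delta<1$, with probability at least $1-\delta$ over $S$, the following hold for all such minimizers: (a) $\mathcal R(\mathcal D,f_C^S,\ell_C)\le\mathcal R(\mathcal D,f_C^{\mathcal D},\ell_C)+2nR_S(\mathcal H)+5B\sqrt{2\log(8/\delta)/K}$; (b) $\mathcal R(\mathcal D,f_{OT}^S,\ell_{OT})\le\mathcal R(\mathcal D,f_{OT}^{\mathcal D},\ell_{OT})+4\mathbf C_\infty n^2R_S(\mathcal H)+5\mathbf C_\infty\sqrt{2\log(8/\delta)/K}$; (c)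 $\mathcal R(\mathcal D,f_{TV}^S,\ell_{TV})\le\mathcal R(\mathcal D,f_{TV}^{\mathcal D},\ell_{TV})+n^2R_S(\mathcal H)+5\sqrt{2\log(8/\delta)/K}$; (d) if $N<\infty$, then $\mathcal R(\mathcal D,f^S,\ell)\le\mathcal R(\mathcal D,f^{\mathcal D},\ell)+(2n+4\lambda_1\mathbf C_\infty n^2+\lambda_2Nn^2)R_S(\mathcal H)+5(B+\lambda_1\mathbf C_\infty+\lambda_2N)\sqrt{2\log(8/\delta)/K}$. -/

import Mathlib

open MeasureTheory Filter Topology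

noncomputable section

namespace CrowdCounting

/-- The `L₁` norm of a vector. -/
def l1 {n : ℕ} (v : Fin n → ℝ) : ℝ := ∑ i, |v i|

/-- The vector divided by its total mass `‖v‖₁`. -/
def normalize {n : ℕ} (v : Fin n → ℝ) : Fin n → ℝ := fun i => v i / l1 v

/-- The transport plans between `μ` and `ν`: nonnegative matrices with row sums `μ` and column
sums `ν`. -/
def transportPlans {n : ℕ} (μ ν : Fin n → ℝ) : Set (Fin n → Fin n → ℝ) :=
  {γ | (∀ i j, 0 ≤ γ i j) ∧ (∀ i, ∑ j, γ i j = μ i) ∧ (∀ j, ∑ i, γ i j = ν j)}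

/-- The Monge-Kantorovich optimal transport cost for the cost matrix `C`: the least value of
`⟨C, γ⟩` over the transport plans `γ`. -/
def otCost {n : ℕ} (C : Fin n → Fin n → ℝ) (μ ν : Fin n → ℝ) : ℝ :=
  sInf ((fun γ : Fin n → Fin n → ℝ => ∑ i, ∑ j, C i j * γ i j) '' transportPlans μ ν)

/-- The largest entry `C_∞` of the cost matrix. -/
def maxCost {n : ℕ} (C : Fin n → Fin n → ℝ) : ℝ := ⨆ p : Fin n × Fin n, C p.1 p.2

/-- The counting loss. -/
def lossC {n : ℕ} (z zhat : Fin n → ℝ) : ℝ := |l1 z - l1 zhat|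

/-- The optimal transport loss, on normalized maps. -/
def lossOT {n : ℕ} (C : Fin n → Fin n → ℝ) (z zhat : Fin n → ℝ) : ℝ :=
  otCost C (normalize z) (normalize zhat)

/-- The total variation loss, on normalized maps. -/
def lossTV {n : ℕ} (z zhat : Fin n → ℝ) : ℝ :=
  (1 / 2) * l1 (normalize z - normalize zhat)

/-- The overall loss, with weights `lam₁` and `lam₂`. -/
def lossAll {n : ℕ} (C : Fin n → Fin n → ℝ) (lam₁ lam₂ : ℝ) (z zhat : Fin n → ℝ) : ℝ :=
  lossC z zhat + lam₁ * lossOT C z zhat + lam₂ * l1 z * lossTV z zhat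

/-- The mapping space `F = H × ⋯ × H` (`n` times): the maps all of whose `n` coordinates
belong to `H`. -/
def mapSpace {X : Type*} (H : Set (X → ℝ)) (n : ℕ) : Set (X → Fin n → ℝ) :=
  {f | ∀ i, (fun x => f x i) ∈ H}

/-- The expected risk of `f` for the loss `ℓ` under the joint law `D` of (image, annotation map). -/
def risk {X : Type*} [MeasurableSpace X] {n : ℕ} (D : Measure (X × (Fin n → ℝ)))
    (ℓ : (Fin n → ℝ) → (Fin n → ℝ) → ℝ) (f : X → Fin n → ℝ) : ℝ :=
  ∫ p, ℓ p.2 (f p.1) ∂D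

/-- The empirical risk of `f` for the loss `ℓ` on the sample `S` of size `K`. -/
def empRisk {X : Type*} {n K : ℕ} (S : Fin K → X × (Fin n → ℝ))
    (ℓ : (Fin n → ℝ) → (Fin n → ℝ) → ℝ) (f : X → Fin n → ℝ) : ℝ :=
  (∑ k, ℓ (S k).2 (f (S k).1)) / K

/-- `f` minimizes `R` over `F`. -/
def IsMinimizer {A : Type*} (F : Set A) (R : A → ℝ) (f : A) : Prop :=
  f ∈ F ∧ ∀ g ∈ F, R f ≤ R g

/-- The empirical Rademacher complexity of `H` on the points `x₁, …, x_K`: the mean over all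
`2 ^ K` choices of signs `σ` of `sup_{h ∈ H} (1 / K) ∑ₖ σₖ h(xₖ)`. -/
def rademacher {X : Type*} {K : ℕ} (H : Set (X → ℝ)) (x : Fin K → X) : ℝ :=
  (∑ σ : Fin K → ℤˣ, ⨆ h : H, (∑ k, ((σ k : ℤ) : ℝ) * (h : X → ℝ) (x k)) / K) / 2 ^ K

/-- `H` is pointwise separable: it has a countable subset such that every element of `H` is
the pointwise limit of a sequence from it. This is the usual condition that makes the suprema
over an uncountable class `H` measurable. -/
def PointwiseSeparable {X : Type*} (H : Set (X → ℝ)) : Prop :=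
  ∃ G : Set (X → ℝ), G ⊆ H ∧ G.Countable ∧
    ∀ h ∈ H, ∃ g : ℕ → X → ℝ, (∀ m, g m ∈ G) ∧
      ∀ x, Tendsto (fun m => g m x) atTop (𝓝 (h x))

/-- `N` is the (finite) maximum count under `D`: the least number that bounds `‖z‖₁` for
almost every `(I, z) ∼ D`. -/
def IsMaxCount {X : Type*} [MeasurableSpace X] {n : ℕ} (D : Measure (X × (Fin n → ℝ)))
    (N : ℝ) : Prop :=
  IsLeast {M : ℝ | ∀ᵐ p ∂D, l1 p.2 ≤ M} N

end CrowdCounting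

end

/-!
A bound for the excess risk of empirical risk minimization follows from a one-sided uniform
deviation bound in terms of the empirical Rademacher complexity of the loss class. For a loss with
values in `[0, c]`, the largest excess of the risk over the empirical risk, minus twice the
Rademacher complexity, plus the deviation of one fixed minimizer of the risk, is a function of the
sample with differences at most `4 c / K` (`exists_event_forall_sub_le`). Its mean is nonpositive by
symmetrization (`integral_iSup_sub_le`), and McDiarmid's inequality
(`hasSubgaussianMGF_of_bounded_differences`) bounds its upper tail. A single application per loss
at level `δ / 4` leaves room for the union bound over the four losses. Suprema over `H × ⋯ × H`
are measurable because they may be taken over tuples from a countable pointwise dense subclass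
(`exists_event_risk_le`).

It remains to bound the Rademacher complexity of each loss class by that of `H`. The counting loss
is `1`-Lipschitz in the sum of the coordinates, so scalar contraction gives `n R_S(H)`. For the
other losses, let `h ∈ H`. The constant tuple `(h, …, h)` belongs to the class, so the assumption
`‖f(I)‖₁ ≥ 1` forces `h ≥ 1 / n` almost surely. On vectors with entries at least `1 / n`, the total
variation distance of the normalized vectors is `n / 2`-Lipschitz for the supremum norm
(`half_l1_normalize_sub_le`). A contraction lemma for the supremum norm (`expect_iSup_sum_le`),
which replaces each sign by `n` independent signs, one for each coordinate, then bounds the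
complexity of a class that is `L`-Lipschitz for that norm by `L n R_S(H)`, because the coordinates
range over `H` independently of each other. This gives `(n ^ 2 / 2) R_S(H)` for the total variation
loss. The transport cost moves by at most the largest cost times the total variation distance
(`otCost_le_add_right`), so the same argument covers the transport loss and, after adding up, the
overall loss.
-/

noncomputable section

namespace CrowdCounting

open ProbabilityTheory
open scoped NNReal BigOperators

/-! ### The bounded differences inequality -/

/-- A measurable function of bounded absolute value is integrable over a probability space. -/
lemma integrable_of_abs_le {α : Type*} [MeasurableSpace α] {μ : Measure α} [IsFiniteMeasure μ]
    {f : α → ℝ} (hf : Measurable f) {M : ℝ} (hM : ∀ a, |f a| ≤ M) : Integrable f μ :=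
  Integrable.of_bound hf.aestronglyMeasurable M (Eventually.of_forall hM)

/-- Integration over `Ω ^ (K + 1)` as an iterated integral, the first coordinate outermost. -/
lemma integral_pi_fin_succ {Ω : Type*} [MeasurableSpace Ω] (D : Measure Ω)
    [IsProbabilityMeasure D] {K : ℕ} {f : (Fin (K + 1) → Ω) → ℝ} (hf : Measurable f) {M : ℝ}
    (hM : ∀ S, |f S| ≤ M) :
    ∫ S, f S ∂(Measure.pi fun _ => D) =
      ∫ ω, ∫ T, f (Fin.cons ω T) ∂(Measure.pi fun _ : Fin K => D) ∂D := by
  have hmp := (measurePreserving_piFinSuccAbove (fun _ : Fin (K + 1) => D) 0).symm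
  rw [← hmp.integral_comp', integral_prod]
  · simp [Fin.insertNthEquiv]
  · exact integrable_of_abs_le (hf.comp (MeasurableEquiv.measurable _)) (fun _ => hM _)

lemma measurable_fin_cons {Ω : Type*} [MeasurableSpace Ω] {K : ℕ} :
    Measurable (fun p : Ω × (Fin K → Ω) => (Fin.cons p.1 p.2 : Fin (K + 1) → Ω)) := by
  refine measurable_pi_iff.2 fun k => ?_
  refine Fin.cases ?_ (fun k => ?_) k
  · simpa using measurable_fst
  · simpa [Function.comp_def] using (measurable_pi_apply k).comp measurable_snd

/-- **McDiarmid's inequality**, in moment generating function form: a bounded measurable function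
of `K` independent variables that moves by at most `c` when one variable is changed is
sub-Gaussian about its mean, with variance proxy `K (c / 2) ^ 2`. The proof integrates out one
variable at a time, and uses Hoeffding's lemma for each. -/
theorem hasSubgaussianMGF_of_bounded_differences {Ω : Type*} [MeasurableSpace Ω] (D : Measure Ω)
    [IsProbabilityMeasure D] (c : ℝ≥0) {M : ℝ} {K : ℕ} {f : (Fin K → Ω) → ℝ}
    (hf : Measurable f) (hM : ∀ S, |f S| ≤ M)
    (hd : ∀ S k ω, f (Function.update S k ω) - f S ≤ c) :
    HasSubgaussianMGF (fun S => f S - ∫ S', f S' ∂(Measure.pi fun _ => D)) (K * (c / 2) ^ 2)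
      (Measure.pi fun _ => D) := by
  induction K with
  | zero =>
    have h : (fun S => f S - ∫ S', f S' ∂(Measure.pi fun _ : Fin 0 => D)) = fun _ => 0 := by
      funext S
      have : f = fun _ => f S := by funext S'; rw [Subsingleton.elim S' S]
      rw [this]; simp
    rw [h]
    simp
  | succ K ih =>
    have hne : Nonempty Ω := nonempty_of_isProbabilityMeasure D
    set P : Measure (Fin K → Ω) := Measure.pi fun _ => D
    set g : Ω → ℝ := fun ω => ∫ T, f (Fin.cons ω T) ∂P with hg
    have hfc : ∀ ω, Measurable fun T : Fin K → Ω => f (Fin.cons ω T) := fun ω =>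
      hf.comp (measurable_fin_cons.comp (measurable_const.prodMk measurable_id))
    have hfi : ∀ ω, Integrable (fun T : Fin K → Ω => f (Fin.cons ω T)) P := fun ω =>
      integrable_of_abs_le (hfc ω) (fun _ => hM _)
    have hgm : Measurable g :=
      ((hf.comp measurable_fin_cons).stronglyMeasurable.integral_prod_right').measurable
    have hgM : ∀ ω, |g ω| ≤ M := fun ω => by
      have := norm_integral_le_of_norm_le_const (μ := P) (f := fun T => f (Fin.cons ω T))
        (C := M) (Eventually.of_forall fun _ => hM _)
      simpa using this
    have hgc : ∀ ω ω', g ω ≤ g ω' + c := fun ω ω' => by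
      have : g ω' + c = ∫ T, (f (Fin.cons ω' T) + c) ∂P := by
        rw [integral_add (hfi _) (integrable_const _)]; simp [hg]
      rw [this]
      refine integral_mono (hfi _) ((hfi _).add (integrable_const _)) fun T => ?_
      have := hd (Fin.cons ω' T) 0 ω
      rw [Fin.update_cons_zero] at this
      dsimp only
      linarith
    have hin : ∀ ω, HasSubgaussianMGF (fun T => f (Fin.cons ω T) - g ω) (K * (c / 2) ^ 2) P :=
      fun ω => ih (hfc ω) (fun _ => hM _) fun T k ω' => by
        have := hd (Fin.cons ω T) k.succ ω'
        rwa [← Fin.cons_update] at this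
    have hbb : BddBelow (Set.range g) := ⟨-M, by rintro _ ⟨ω, rfl⟩; exact (abs_le.1 (hgM ω)).1⟩
    have hout : HasSubgaussianMGF (fun ω => g ω - ∫ ω', g ω' ∂D) ((c / 2) ^ 2) D := by
      have := hasSubgaussianMGF_of_mem_Icc (μ := D) (X := g) (a := ⨅ ω, g ω)
        (b := (⨅ ω, g ω) + c) hgm.aemeasurable (Eventually.of_forall fun ω =>
          ⟨ciInf_le hbb ω, by
            have : g ω - c ≤ ⨅ ω', g ω' := le_ciInf fun ω' => by linarith [hgc ω ω']
            linarith⟩)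
      simpa using this
    set m : ℝ := ∫ S, f S ∂(Measure.pi fun _ : Fin (K + 1) => D) with hm
    have hmg : m = ∫ ω, g ω ∂D := integral_pi_fin_succ D hf hM
    have hbd : ∀ t S, |Real.exp (t * (f S - m))| ≤ Real.exp (|t| * (M + |m|)) := fun t S => by
      rw [abs_of_pos (Real.exp_pos _)]
      refine Real.exp_le_exp.2 ((le_abs_self _).trans ?_)
      rw [abs_mul]
      gcongr
      exact (abs_sub _ _).trans (by gcongr; exact hM S)
    have hme : ∀ t, Measurable fun S => Real.exp (t * (f S - m)) := fun t =>
      ((hf.sub_const _).const_mul _).exp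
    refine ⟨fun t => integrable_of_abs_le (hme t) (hbd t), fun t => ?_⟩
    calc mgf (fun S => f S - m) (Measure.pi fun _ => D) t
        = ∫ ω, ∫ T, Real.exp (t * (f (Fin.cons ω T) - m)) ∂P ∂D :=
          integral_pi_fin_succ D (hme t) (hbd t)
      _ = ∫ ω, Real.exp (t * (g ω - ∫ ω', g ω' ∂D)) *
            mgf (fun T => f (Fin.cons ω T) - g ω) P t ∂D := by
          congr 1; funext ω
          rw [mgf, ← integral_const_mul]
          congr 1; funext T
          rw [← Real.exp_add, ← hmg]; congr 1; ring
      _ ≤ ∫ ω, Real.exp (t * (g ω - ∫ ω', g ω' ∂D)) *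
            Real.exp (((K * (c / 2) ^ 2 : ℝ≥0) : ℝ) * t ^ 2 / 2) ∂D := by
          refine integral_mono_of_nonneg (Eventually.of_forall fun ω => ?_)
            ((hout.integrable_exp_mul t).mul_const _) (Eventually.of_forall fun ω => ?_)
          · exact mul_nonneg (Real.exp_pos _).le mgf_nonneg
          · exact mul_le_mul_of_nonneg_left ((hin ω).mgf_le t) (Real.exp_pos _).le
      _ = mgf (fun ω => g ω - ∫ ω', g ω' ∂D) D t *
            Real.exp (((K * (c / 2) ^ 2 : ℝ≥0) : ℝ) * t ^ 2 / 2) := by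
          rw [integral_mul_const, mgf]
      _ ≤ Real.exp ((((c / 2) ^ 2 : ℝ≥0) : ℝ) * t ^ 2 / 2) *
            Real.exp (((K * (c / 2) ^ 2 : ℝ≥0) : ℝ) * t ^ 2 / 2) :=
          mul_le_mul_of_nonneg_right (hout.mgf_le t) (Real.exp_pos _).le
      _ = Real.exp ((((K + 1 : ℕ) * (c / 2) ^ 2 : ℝ≥0) : ℝ) * t ^ 2 / 2) := by
          rw [← Real.exp_add]; congr 1; push_cast; ring

/-- The tail bound that McDiarmid's inequality gives for a function of nonpositive mean whose
differences are at most `c / K`: off an event of probability `η` the function is at most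
`c √(log (1 / η) / (2 K))`. -/
theorem measure_bounded_differences_le {Ω : Type*} [MeasurableSpace Ω] (D : Measure Ω)
    [IsProbabilityMeasure D] {c M η : ℝ} {K : ℕ} (hK : 0 < K) (hc : 0 < c)
    (hη0 : 0 < η) (hη1 : η < 1) {f : (Fin K → Ω) → ℝ}
    (hf : Measurable f) (hM : ∀ S, |f S| ≤ M)
    (hd : ∀ S k ω, f (Function.update S k ω) - f S ≤ c / K)
    (hmean : ∫ S, f S ∂(Measure.pi fun _ => D) ≤ 0) :
    (Measure.pi fun _ => D).real {S | c * √(Real.log (1 / η) / (2 * K)) ≤ f S} ≤ η := by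
  have hK' : (0 : ℝ) < K := Nat.cast_pos.2 hK
  have hlog : 0 < Real.log (1 / η) := Real.log_pos (by rw [lt_div_iff₀ hη0]; linarith)
  set ε : ℝ := c * √(Real.log (1 / η) / (2 * K)) with hε
  obtain ⟨d, hdK⟩ : ∃ d : ℝ≥0, (d : ℝ) = c / K := ⟨⟨c / K, by positivity⟩, rfl⟩
  have hsub := hasSubgaussianMGF_of_bounded_differences D d hf hM (by rwa [hdK])
  have h := hsub.measure_ge_le (ε := ε) (by positivity)
  have hsq : ε ^ 2 = c ^ 2 * (Real.log (1 / η) / (2 * K)) := by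
    rw [hε, mul_pow, Real.sq_sqrt (by positivity)]
  refine (measureReal_mono fun S hS => ?_).trans (h.trans_eq ?_)
  · simp only [Set.mem_ofPred_eq] at hS ⊢
    linarith
  · have : -ε ^ 2 / (2 * ((K * (d / 2) ^ 2 : ℝ≥0) : ℝ)) = Real.log η := by
      push_cast
      rw [hsq, hdK, one_div, Real.log_inv]
      field_simp
    rw [this, Real.exp_log hη0]

/-! ### Symmetrization -/

/-- The mean of `v` over the points, weighted by `s`. -/
def wavg {K : ℕ} (s v : Fin K → ℝ) : ℝ := (∑ k, s k * v k) / K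

/-- The signs `σ` as real weights. -/
def sgn {J : Type*} (σ : J → ℤˣ) : J → ℝ := fun k => ((σ k : ℤ) : ℝ)

/-- The Rademacher complexity of a family `ψ` of vectors in `ℝ ^ K`: the values that a class of
functions takes on a sample of size `K`. -/
def radComplexity {ι : Type*} {K : ℕ} (ψ : ι → Fin K → ℝ) : ℝ :=
  𝔼 σ : Fin K → ℤˣ, ⨆ i, wavg (sgn σ) (ψ i)

lemma abs_sgn {J : Type*} (σ : J → ℤˣ) (k : J) : |sgn σ k| = 1 := by
  rcases Int.units_eq_one_or (σ k) with h | h <;> simp [sgn, h]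

lemma sgn_neg {J : Type*} (σ : J → ℤˣ) (k : J) : sgn (-σ) k = -sgn σ k := by
  simp [sgn]

lemma rademacher_eq {X : Type*} {K : ℕ} (H : Set (X → ℝ)) (x : Fin K → X) :
    rademacher H x = radComplexity (fun (h : H) k => (h : X → ℝ) (x k)) := by
  rw [rademacher, radComplexity, Fintype.expect_eq_sum_div_card]
  simp [wavg, sgn]

lemma abs_wavg_le {K : ℕ} (hK : 0 < K) {s v : Fin K → ℝ} {c : ℝ} (hs : ∀ k, |s k| ≤ 1)
    (hv : ∀ k, |v k| ≤ c) : |wavg s v| ≤ c := by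
  have hK' : (0 : ℝ) < K := Nat.cast_pos.2 hK
  rw [wavg, abs_div, abs_of_pos hK', div_le_iff₀ hK']
  refine (Finset.abs_sum_le_sum_abs _ _).trans ?_
  calc ∑ k, |s k * v k| ≤ ∑ _k : Fin K, c := Finset.sum_le_sum fun k _ => by
        rw [abs_mul]
        have := abs_nonneg (v k)
        nlinarith [hs k, hv k]
    _ = c * K := by simp [mul_comm]

/-- Changing one sample point moves a weighted mean by at most `c / K`. -/
lemma abs_wavg_update_sub_le {Ω : Type*} {K : ℕ} {s : Fin K → ℝ} {ψ : Ω → ℝ} {c : ℝ}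
    (hs : ∀ k, |s k| ≤ 1) (h0 : ∀ ω, 0 ≤ ψ ω) (hc : ∀ ω, ψ ω ≤ c) (S : Fin K → Ω) (j : Fin K)
    (ω : Ω) :
    |wavg s (fun k => ψ (Function.update S j ω k)) - wavg s (fun k => ψ (S k))| ≤ c / K := by
  rw [wavg, wavg, ← sub_div, ← Finset.sum_sub_distrib, Finset.sum_eq_single j, abs_div,
    Nat.abs_cast]
  · gcongr
    rw [Function.update_self, ← mul_sub, abs_mul]
    have : |ψ ω - ψ (S j)| ≤ c := abs_le.2 ⟨by linarith [h0 ω, hc (S j)], by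
      linarith [hc ω, h0 (S j)]⟩
    nlinarith [hs j, abs_nonneg (ψ ω - ψ (S j))]
  · intro k _ hk
    simp [Function.update_of_ne hk]
  · simp

lemma ciSup_le_ciSup_add {ι : Type*} [Nonempty ι] {a b : ι → ℝ} {d M : ℝ} (hb : ∀ i, b i ≤ M)
    (h : ∀ i, a i ≤ b i + d) : ⨆ i, a i ≤ (⨆ i, b i) + d :=
  ciSup_le fun i => (h i).trans
    (add_le_add_left (le_ciSup (f := b) ⟨M, by rintro _ ⟨i, rfl⟩; exact hb i⟩ i) d)

lemma abs_ciSup_le {ι : Type*} [Nonempty ι] {a : ι → ℝ} {M : ℝ} (h : ∀ i, |a i| ≤ M) :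
    |⨆ i, a i| ≤ M := by
  inhabit ι
  refine abs_le.2 ⟨(abs_le.1 (h default)).1.trans
    (le_ciSup (f := a) ⟨M, ?_⟩ default), ciSup_le fun i => (abs_le.1 (h i)).2⟩
  rintro _ ⟨i, rfl⟩
  exact (abs_le.1 (h i)).2

lemma abs_expect_le {α : Type*} [Fintype α] [Nonempty α] {a : α → ℝ} {M : ℝ}
    (h : ∀ i, |a i| ≤ M) : |𝔼 i, a i| ≤ M :=
  (Finset.abs_expect_le _ _).trans
    (Finset.expect_le Finset.univ_nonempty fun i _ => h i)

lemma measurable_wavg {Ω : Type*} [MeasurableSpace Ω] {K : ℕ} (s : Fin K → ℝ)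
    {v : Ω → Fin K → ℝ} (hv : ∀ k, Measurable fun ω => v ω k) :
    Measurable fun ω => wavg s (v ω) := by
  unfold wavg
  exact (Finset.measurable_sum _ fun k _ => (hv k).const_mul _).div_const _

lemma measurable_radComplexity {Ω ι : Type*} [MeasurableSpace Ω] [Countable ι] {K : ℕ}
    {ψ : Ω → ι → Fin K → ℝ} (hψ : ∀ i k, Measurable fun ω => ψ ω i k) :
    Measurable fun ω => radComplexity (ψ ω) := by
  simp only [radComplexity, Fintype.expect_eq_sum_div_card]
  exact (Finset.measurable_sum _ fun σ _ =>
    Measurable.iSup fun i => measurable_wavg _ (hψ i)).div_const _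

lemma integral_wavg_one {Ω : Type*} [MeasurableSpace Ω] (D : Measure Ω) [IsProbabilityMeasure D]
    {K : ℕ} (hK : 0 < K) {ψ : Ω → ℝ} (hψ : Measurable ψ) {c : ℝ} (hc : ∀ ω, |ψ ω| ≤ c) :
    ∫ S, wavg (fun _ => 1) (fun k => ψ (S k)) ∂(Measure.pi fun _ : Fin K => D) = ∫ ω, ψ ω ∂D := by
  have hK' : (K : ℝ) ≠ 0 := Nat.cast_ne_zero.2 hK.ne'
  simp only [wavg, one_mul]
  rw [integral_div, integral_finsetSum]
  · have : ∀ k : Fin K, ∫ S, ψ (S k) ∂(Measure.pi fun _ : Fin K => D) = ∫ ω, ψ ω ∂D := fun k => by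
      have hmp := measurePreserving_eval (fun _ : Fin K => D) k
      have h := integral_map (μ := Measure.pi fun _ : Fin K => D) hmp.measurable.aemeasurable
        (f := ψ) hψ.aestronglyMeasurable
      rw [hmp.map_eq] at h
      exact h.symm
    simp [this, hK']
  · exact fun k _ => integrable_of_abs_le (hψ.comp (measurable_pi_apply k)) fun _ => hc _

/-- Exchanging a sample and an independent copy of it at the coordinates in which `σ` is `-1`
preserves their joint law. -/
lemma measurePreserving_swap {Ω : Type*} [MeasurableSpace Ω] (D : Measure Ω)
    [IsProbabilityMeasure D] {K : ℕ} (σ : Fin K → ℤˣ) :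
    MeasurePreserving
      (fun p : (Fin K → Ω) × (Fin K → Ω) =>
        ((fun k => if σ k = 1 then p.1 k else p.2 k),
          (fun k => if σ k = 1 then p.2 k else p.1 k)))
      ((Measure.pi fun _ => D).prod (Measure.pi fun _ => D))
      ((Measure.pi fun _ => D).prod (Measure.pi fun _ => D)) := by
  have he := measurePreserving_arrowProdEquivProdArrow Ω Ω (Fin K) (fun _ => D) (fun _ => D)
  have hs := measurePreserving_pi (fun _ : Fin K => D.prod D) (fun _ : Fin K => D.prod D)
    (f := fun k p => if σ k = 1 then p else p.swap) (fun k => by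
      by_cases h : σ k = 1
      · simpa [h] using! MeasurePreserving.id _
      · simpa [h] using Measure.measurePreserving_swap)
  convert (he.comp hs).comp he.symm using 1
  funext p
  refine Prod.ext (funext fun k => ?_) (funext fun k => ?_) <;>
    by_cases h : σ k = 1 <;>
    simp [h, MeasurableEquiv.arrowProdEquivProdArrow, Equiv.arrowProdEquivProdArrow]

/-- **Symmetrization**: the mean of the largest excess of the expectation over the empirical mean
is at most twice the mean of the Rademacher complexity. -/
theorem integral_iSup_sub_le {Ω ι : Type*} [MeasurableSpace Ω] (D : Measure Ω)
    [IsProbabilityMeasure D] [Countable ι] [Nonempty ι] {K : ℕ} (hK : 0 < K) {ψ : ι → Ω → ℝ}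
    (hψ : ∀ i, Measurable (ψ i)) {c : ℝ} (h0 : ∀ i ω, 0 ≤ ψ i ω) (hc : ∀ i ω, ψ i ω ≤ c) :
    ∫ S, (⨆ i, (∫ ω, ψ i ω ∂D - wavg (fun _ => 1) (fun k => ψ i (S k))))
        ∂(Measure.pi fun _ : Fin K => D) ≤
      2 * ∫ S, radComplexity (fun i k => ψ i (S k)) ∂(Measure.pi fun _ : Fin K => D) := by
  set P : Measure (Fin K → Ω) := Measure.pi fun _ => D
  have hψc : ∀ i ω, |ψ i ω| ≤ c := fun i ω => by rw [abs_of_nonneg (h0 i ω)]; exact hc i ω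
  have hdc : ∀ i ω ω', |ψ i ω' - ψ i ω| ≤ c := fun i ω ω' => abs_le.2
    ⟨by linarith [h0 i ω', hc i ω], by linarith [h0 i ω, hc i ω']⟩
  have h1 : ∀ k : Fin K, |(1 : ℝ)| ≤ 1 := fun _ => by simp
  have hσ1 : ∀ (σ : Fin K → ℤˣ) k, |sgn σ k| ≤ 1 := fun σ k => (abs_sgn σ k).le
  -- the symmetrized excess, with the ghost sample `p.2`
  let A : (Fin K → ℝ) → (Fin K → Ω) × (Fin K → Ω) → ℝ := fun s p =>
    ⨆ i, wavg s (fun k => ψ i (p.2 k) - ψ i (p.1 k))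
  let R : (Fin K → ℝ) → (Fin K → Ω) → ℝ := fun s S => ⨆ i, wavg s (fun k => ψ i (S k))
  have hAm : ∀ s, Measurable (A s) := fun s => Measurable.iSup fun i => measurable_wavg _ fun k =>
    ((hψ i).comp ((measurable_pi_apply k).comp measurable_snd)).sub
      ((hψ i).comp ((measurable_pi_apply k).comp measurable_fst))
  have hRm : ∀ s, Measurable (R s) := fun s => Measurable.iSup fun i => measurable_wavg _ fun k =>
    (hψ i).comp (measurable_pi_apply k)
  have hAi : ∀ s, (∀ k, |s k| ≤ 1) → Integrable (A s) (P.prod P) := fun s hs =>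
    integrable_of_abs_le (hAm s) fun p => abs_ciSup_le fun i => abs_wavg_le hK hs fun k => hdc i _ _
  have hRi : ∀ s, (∀ k, |s k| ≤ 1) → Integrable (R s) P := fun s hs =>
    integrable_of_abs_le (hRm s) fun p => abs_ciSup_le fun i => abs_wavg_le hK hs fun k => hψc i _
  have hghost : ∫ S, (⨆ i, (∫ ω, ψ i ω ∂D - wavg (fun _ => 1) (fun k => ψ i (S k)))) ∂P ≤
      ∫ p, A (fun _ => 1) p ∂(P.prod P) := by
    rw [integral_prod _ (hAi _ h1)]
    have hdev : ∀ S : Fin K → Ω, ∀ i,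
        ∫ ω, ψ i ω ∂D - wavg (fun _ => 1) (fun k => ψ i (S k)) =
          ∫ S', wavg (fun _ => 1) (fun k => ψ i (S' k) - ψ i (S k)) ∂P := fun S i => by
      have hw : ∀ S' : Fin K → Ω, wavg (fun _ => 1) (fun k => ψ i (S' k) - ψ i (S k)) =
          wavg (fun _ => 1) (fun k => ψ i (S' k)) - wavg (fun _ => 1) (fun k => ψ i (S k)) :=
        fun S' => by simp [wavg, ← sub_div]
      simp_rw [hw]
      rw [integral_sub _ (integrable_const _), integral_wavg_one D hK (hψ i) (hψc i)]
      · simp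
      · exact integrable_of_abs_le (measurable_wavg _ fun k => (hψ i).comp (measurable_pi_apply k))
          fun _ => abs_wavg_le hK h1 fun k => hψc i _
    have hAS : ∀ S, Integrable (fun S' => A (fun _ => 1) (S, S')) P := fun S =>
      integrable_of_abs_le ((hAm _).comp (measurable_const.prodMk measurable_id)) fun p =>
        abs_ciSup_le fun i => abs_wavg_le hK h1 fun k => hdc i _ _
    have hpt : ∀ S, (⨆ i, (∫ ω, ψ i ω ∂D - wavg (fun _ => 1) (fun k => ψ i (S k)))) ≤
        ∫ S', A (fun _ => 1) (S, S') ∂P := fun S => ciSup_le fun i => by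
      rw [hdev]
      refine integral_mono ?_ (hAS S) fun S' => ?_
      · exact integrable_of_abs_le (measurable_wavg _ fun k =>
          ((hψ i).comp (measurable_pi_apply k)).sub_const _) fun _ =>
            abs_wavg_le hK h1 fun k => hdc i _ _
      · refine le_ciSup (f := fun i => wavg (fun _ => 1) fun k => ψ i (S' k) - ψ i (S k)) ⟨c, ?_⟩ i
        rintro _ ⟨i, rfl⟩
        exact (le_abs_self _).trans (abs_wavg_le hK h1 fun k => hdc i _ _)
    refine integral_mono ?_ (hAi _ h1).integral_prod_left hpt
    refine integrable_of_abs_le (M := c) (Measurable.iSup fun i => (measurable_wavg _ fun k =>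
      (hψ i).comp (measurable_pi_apply k)).const_sub _) fun S => abs_ciSup_le fun i => ?_
    rw [hdev]
    have := norm_integral_le_of_norm_le_const (μ := P)
      (f := fun S' => wavg (fun _ => 1) fun k => ψ i (S' k) - ψ i (S k)) (C := c)
      (Eventually.of_forall fun _ => abs_wavg_le hK h1 fun k => hdc i _ _)
    simpa using this
  -- exchanging the two samples where the sign is `-1` introduces the signs
  have hswap : ∀ σ : Fin K → ℤˣ,
      ∫ p, A (fun _ => 1) p ∂(P.prod P) = ∫ p, A (sgn σ) p ∂(P.prod P) := fun σ => by
    have hmp := measurePreserving_swap D σ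
    rw [← hmp.map_eq, integral_map hmp.measurable.aemeasurable (hAm _).aestronglyMeasurable,
      hmp.map_eq]
    congr 1; funext p
    refine iSup_congr fun i => ?_
    simp only [wavg]
    congr 1
    refine Finset.sum_congr rfl fun k _ => ?_
    rcases Int.units_eq_one_or (σ k) with h | h <;> simp [sgn, h]
  have hsplit : ∀ σ : Fin K → ℤˣ, ∫ p, A (sgn σ) p ∂(P.prod P) ≤
      ∫ S, R (sgn σ) S ∂P + ∫ S, R (sgn (-σ)) S ∂P := fun σ => by
    have hfst : ∫ p, R (sgn (-σ)) p.1 ∂(P.prod P) = ∫ S, R (sgn (-σ)) S ∂P := by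
      simpa using integral_fun_fst (μ := P) (ν := P) (R (sgn (-σ)))
    have hsnd : ∫ p, R (sgn σ) p.2 ∂(P.prod P) = ∫ S, R (sgn σ) S ∂P := by
      simpa using integral_fun_snd (μ := P) (ν := P) (R (sgn σ))
    have i1 : Integrable (fun p : (Fin K → Ω) × (Fin K → Ω) => R (sgn σ) p.2) (P.prod P) :=
      (hRi _ (hσ1 σ)).comp_snd P
    have i2 : Integrable (fun p : (Fin K → Ω) × (Fin K → Ω) => R (sgn (-σ)) p.1) (P.prod P) :=
      (hRi _ (hσ1 (-σ))).comp_fst P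
    rw [← hfst, ← hsnd, ← integral_add i1 i2]
    refine integral_mono (hAi _ (hσ1 σ)) (i1.add i2) fun p => ciSup_le fun i => ?_
    have hb : ∀ (σ : Fin K → ℤˣ) (S : Fin K → Ω),
        BddAbove (Set.range fun i => wavg (sgn σ) fun k => ψ i (S k)) := fun σ S => by
      refine ⟨c, ?_⟩
      rintro _ ⟨i, rfl⟩
      exact (le_abs_self _).trans (abs_wavg_le hK (hσ1 σ) fun k => hψc i _)
    have hw : wavg (sgn σ) (fun k => ψ i (p.2 k) - ψ i (p.1 k)) =
        wavg (sgn σ) (fun k => ψ i (p.2 k)) + wavg (sgn (-σ)) (fun k => ψ i (p.1 k)) := by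
      simp only [wavg, ← add_div, ← Finset.sum_add_distrib, sgn_neg]
      congr 1
      exact Finset.sum_congr rfl fun k _ => by ring
    rw [hw]
    exact add_le_add (le_ciSup (hb _ _) i) (le_ciSup (hb _ _) i)
  have hrad : ∫ S, radComplexity (fun i k => ψ i (S k)) ∂P =
      𝔼 σ : Fin K → ℤˣ, ∫ S, R (sgn σ) S ∂P := by
    simp only [radComplexity, Fintype.expect_eq_sum_div_card]
    rw [integral_div, integral_finsetSum _ fun σ _ => hRi _ (hσ1 σ)]
  calc _ ≤ ∫ p, A (fun _ => 1) p ∂(P.prod P) := hghost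
    _ = 𝔼 σ : Fin K → ℤˣ, ∫ p, A (sgn σ) p ∂(P.prod P) := by
        rw [← Finset.expect_congr rfl fun σ _ => hswap σ, Fintype.expect_const]
    _ ≤ 𝔼 σ : Fin K → ℤˣ, (∫ S, R (sgn σ) S ∂P + ∫ S, R (sgn (-σ)) S ∂P) :=
        Finset.expect_le_expect fun σ _ => hsplit σ
    _ = 2 * ∫ S, radComplexity (fun i k => ψ i (S k)) ∂P := by
        rw [Finset.expect_add_distrib, hrad, two_mul]
        congr 1
        exact Fintype.expect_equiv (Equiv.neg _) _ _ fun σ => rfl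

/-- The one-sided uniform deviation bound. With probability at least `1 - η`, every member `ψ i`
of a countable class of `[0, c]`-valued functions satisfies the bound, which also contains the
deviation, in the opposite direction, of one fixed function `ψ₀`. The supremum over the class, the
Rademacher complexity and the deviation of `ψ₀` are combined into a single function of the sample,
whose mean is nonpositive by symmetrization and whose differences are at most `4 c / K`. -/
theorem exists_event_forall_sub_le {Ω ι : Type*} [MeasurableSpace Ω] (D : Measure Ω)
    [IsProbabilityMeasure D] [Countable ι] [Nonempty ι] {K : ℕ} (hK : 0 < K) {ψ : ι → Ω → ℝ}
    (hψ : ∀ i, Measurable (ψ i)) {c : ℝ} (h0 : ∀ i ω, 0 ≤ ψ i ω) (hc : ∀ i ω, ψ i ω ≤ c)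
    {ψ₀ : Ω → ℝ} (hψ₀ : Measurable ψ₀) (h00 : ∀ ω, 0 ≤ ψ₀ ω) (hc0 : ∀ ω, ψ₀ ω ≤ c)
    {η : ℝ} (hη0 : 0 < η) (hη1 : η < 1) :
    ∃ E : Set (Fin K → Ω), MeasurableSet E ∧
      ENNReal.ofReal (1 - η) ≤ Measure.pi (fun _ : Fin K => D) E ∧
      ∀ S ∈ E, ∀ i,
        ∫ ω, ψ i ω ∂D - wavg (fun _ => 1) (fun k => ψ i (S k))
            + (wavg (fun _ => 1) (fun k => ψ₀ (S k)) - ∫ ω, ψ₀ ω ∂D) ≤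
          2 * radComplexity (fun i k => ψ i (S k)) + 4 * c * √(Real.log (1 / η) / (2 * K)) := by
  set P : Measure (Fin K → Ω) := Measure.pi fun _ => D
  have hne : Nonempty Ω := nonempty_of_isProbabilityMeasure D
  have hcnn : 0 ≤ c := (h00 hne.some).trans (hc0 hne.some)
  rcases hcnn.eq_or_lt with rfl | hcpos
  · have e1 : ∀ i ω, ψ i ω = 0 := fun i ω => le_antisymm (hc i ω) (h0 i ω)
    have e2 : ∀ ω, ψ₀ ω = 0 := fun ω => le_antisymm (hc0 ω) (h00 ω)
    refine ⟨Set.univ, MeasurableSet.univ, ?_, fun S _ i => ?_⟩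
    · simpa using hη0.le
    · simp [e1, e2, radComplexity, wavg]
  have hψc : ∀ i ω, |ψ i ω| ≤ c := fun i ω => by rw [abs_of_nonneg (h0 i ω)]; exact hc i ω
  have hψ₀c : ∀ ω, |ψ₀ ω| ≤ c := fun ω => by rw [abs_of_nonneg (h00 ω)]; exact hc0 ω
  have h1 : ∀ k : Fin K, |(1 : ℝ)| ≤ 1 := fun _ => by simp
  have hσ1 : ∀ (σ : Fin K → ℤˣ) k, |sgn σ k| ≤ 1 := fun σ k => (abs_sgn σ k).le
  have hint : ∀ φ : Ω → ℝ, (∀ ω, |φ ω| ≤ c) → |∫ ω, φ ω ∂D| ≤ c := fun φ hφ => by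
    simpa using norm_integral_le_of_norm_le_const (μ := D) (f := φ) (C := c)
      (Eventually.of_forall hφ)
  let V : (Fin K → Ω) → ℝ := fun S =>
    ⨆ i, (∫ ω, ψ i ω ∂D - wavg (fun _ => 1) (fun k => ψ i (S k)))
  let Q : (Fin K → Ω) → ℝ := fun S => radComplexity (fun i k => ψ i (S k))
  let W : (Fin K → Ω) → ℝ := fun S => wavg (fun _ => 1) (fun k => ψ₀ (S k))
  have hVm : Measurable V := Measurable.iSup fun i => (measurable_wavg _ fun k =>
    (hψ i).comp (measurable_pi_apply k)).const_sub _
  have hQm : Measurable Q := measurable_radComplexity fun i k => (hψ i).comp (measurable_pi_apply k)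
  have hWm : Measurable W := measurable_wavg _ fun k => hψ₀.comp (measurable_pi_apply k)
  have hVt : ∀ (S : Fin K → Ω) i,
      |∫ ω, ψ i ω ∂D - wavg (fun _ => 1) (fun k => ψ i (S k))| ≤ 2 * c :=
    fun S i => (abs_sub _ _).trans (by
      linarith [hint _ (hψc i), abs_wavg_le hK h1 (fun k => hψc i (S k))])
  have hVb : ∀ S, |V S| ≤ 2 * c := fun S => abs_ciSup_le (hVt S)
  have hQb : ∀ S, |Q S| ≤ c := fun S => abs_expect_le fun σ => abs_ciSup_le fun i =>
    abs_wavg_le hK (hσ1 σ) fun k => hψc i _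
  have hWb : ∀ S, |W S| ≤ c := fun S => abs_wavg_le hK h1 fun k => hψ₀c _
  let f : (Fin K → Ω) → ℝ := fun S => V S - 2 * Q S + (W S - ∫ ω, ψ₀ ω ∂D)
  have hfm : Measurable f := (hVm.sub (hQm.const_mul 2)).add (hWm.sub_const _)
  have hfb : ∀ S, |f S| ≤ 6 * c := fun S => by
    have a := abs_le.1 (hVb S)
    have b := abs_le.1 (hQb S)
    have d := abs_le.1 (hWb S)
    have e := abs_le.1 (hint _ hψ₀c)
    exact abs_le.2 ⟨by simp only [f]; linarith [a.1, b.2, d.1, e.2], by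
      simp only [f]; linarith [a.2, b.1, d.2, e.1]⟩
  have hfd : ∀ S k ω, f (Function.update S k ω) - f S ≤ 4 * c / K := fun S k ω => by
    have hV : V (Function.update S k ω) ≤ V S + c / K :=
      ciSup_le_ciSup_add (M := 2 * c) (fun i => (le_abs_self _).trans (hVt S i)) fun i => by
        have := (abs_le.1 (abs_wavg_update_sub_le h1 (h0 i) (hc i) S k ω)).1
        linarith
    have hQ : Q S ≤ Q (Function.update S k ω) + c / K := by
      simp only [Q, radComplexity]
      have hcst : c / K = 𝔼 _σ : Fin K → ℤˣ, c / K := (Fintype.expect_const _).symm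
      rw [hcst, ← Finset.expect_add_distrib]
      refine Finset.expect_le_expect fun σ _ => ciSup_le_ciSup_add (M := c)
        (fun i => (le_abs_self _).trans (abs_wavg_le hK (hσ1 σ) fun k => hψc i _)) fun i => ?_
      have := (abs_le.1 (abs_wavg_update_sub_le (hσ1 σ) (h0 i) (hc i) S k ω)).1
      linarith
    have hW : W (Function.update S k ω) ≤ W S + c / K := by
      have := (abs_le.1 (abs_wavg_update_sub_le h1 h00 hc0 S k ω)).2
      simp only [W]
      linarith
    simp only [f]
    have : 4 * c / K = 4 * (c / K) := by ring
    linarith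
  have hVi : Integrable V P := integrable_of_abs_le hVm hVb
  have hQi : Integrable Q P := integrable_of_abs_le hQm hQb
  have hWi : Integrable W P := integrable_of_abs_le hWm hWb
  have hmean : ∫ S, f S ∂P ≤ 0 := by
    have hsym := integral_iSup_sub_le D hK hψ h0 hc
    have hW0 : ∫ S, W S ∂P = ∫ ω, ψ₀ ω ∂D := integral_wavg_one D hK hψ₀ hψ₀c
    have : ∫ S, f S ∂P = ∫ S, V S ∂P - 2 * ∫ S, Q S ∂P + (∫ S, W S ∂P - ∫ ω, ψ₀ ω ∂D) := by
      have i1 : Integrable (fun S => V S - 2 * Q S) P := hVi.sub (hQi.const_mul 2)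
      have i2 : Integrable (fun S => W S - ∫ ω, ψ₀ ω ∂D) P := hWi.sub (integrable_const _)
      simp only [f]
      rw [integral_add i1 i2, integral_sub hVi (hQi.const_mul 2),
        integral_sub hWi (integrable_const _), integral_const_mul]
      simp
    rw [this, hW0]
    linarith
  have htail := measure_bounded_differences_le D hK (by positivity : 0 < 4 * c) hη0 hη1 hfm hfb
    hfd hmean
  have hbad : MeasurableSet {S | 4 * c * √(Real.log (1 / η) / (2 * K)) ≤ f S} :=
    measurableSet_le measurable_const hfm
  refine ⟨_, hbad.compl, ?_, fun S hS i => ?_⟩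
  · refine ENNReal.ofReal_le_of_le_toReal ?_
    change _ ≤ P.real _
    rw [probReal_compl_eq_one_sub hbad]
    linarith
  · have hlt : f S < 4 * c * √(Real.log (1 / η) / (2 * K)) := by simpa using hS
    have hi : ∫ ω, ψ i ω ∂D - wavg (fun _ => 1) (fun k => ψ i (S k)) ≤ V S :=
      le_ciSup (f := fun i => ∫ ω, ψ i ω ∂D - wavg (fun _ => 1) (fun k => ψ i (S k)))
        ⟨2 * c, by rintro _ ⟨i, rfl⟩; exact (le_abs_self _).trans (hVt S i)⟩ i
    simp only [f, W, Q] at hlt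
    linarith

/-! ### Contraction for vector-valued classes -/

lemma expect_fin_succ {α : Type*} [Fintype α] {m : ℕ} (F : (Fin (m + 1) → α) → ℝ) :
    𝔼 σ, F σ = 𝔼 a, 𝔼 σ, F (Fin.cons a σ) := by
  rw [← Finset.expect_product', Finset.univ_product_univ]
  exact (Fintype.expect_equiv (Fin.consEquiv fun _ => α) _ _ fun p => rfl).symm

/-- A column of a matrix of independent signs is a vector of independent signs. -/
lemma expect_column {J : Type*} [Fintype J] [DecidableEq J] {K : ℕ} (F : (Fin K → ℤˣ) → ℝ)
    (j : J) : 𝔼 τ : Fin K → J → ℤˣ, F (fun k => τ k j) = 𝔼 σ, F σ := by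
  rw [Fintype.expect_equiv (Equiv.piComm fun (_ : Fin K) (_ : J) => ℤˣ)
    (fun τ => F fun k => τ k j) (fun τ : J → Fin K → ℤˣ => F (τ j)) fun τ => rfl]
  rw [Fintype.expect_equiv (Equiv.funSplitAt j (Fin K → ℤˣ)) (fun τ => F (τ j))
    (fun p : (Fin K → ℤˣ) × ({i // i ≠ j} → Fin K → ℤˣ) => F p.1) fun τ => rfl]
  rw [← Finset.univ_product_univ, Finset.expect_product]
  simp

lemma expect_units (F : ℤˣ → ℝ) : 𝔼 s, F s = (F 1 + F (-1)) / 2 := by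
  rw [Fintype.expect_eq_sum_div_card, UnitsInt.univ]
  simp

/-- Among the signed sums of `d`, weighted by the `j`-th sign, all terms but `d j` cancel. -/
lemma expect_sgn_mul_sum {J : Type*} [Fintype J] [DecidableEq J] (d : J → ℝ) (j : J) :
    𝔼 ε : J → ℤˣ, sgn ε j * ∑ i, sgn ε i * d i = d j := by
  have hinv : Function.Involutive
      fun (ε : J → ℤˣ) => (fun i => if i = j then ε i else -ε i : J → ℤˣ) := by
    intro ε
    funext i
    by_cases h : i = j <;> simp [h]
  let flip : Equiv.Perm (J → ℤˣ) := Function.Involutive.toPerm _ hinv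
  have hf : ∀ ε i, flip ε i = if i = j then ε i else -ε i := fun _ _ => rfl
  have hflip : 𝔼 ε : J → ℤˣ, sgn (flip ε) j * ∑ i, sgn (flip ε) i * d i =
      𝔼 ε : J → ℤˣ, sgn ε j * ∑ i, sgn ε i * d i := Fintype.expect_equiv flip _ _ fun ε => rfl
  have hpair : ∀ ε : J → ℤˣ, sgn (flip ε) j * ∑ i, sgn (flip ε) i * d i +
      sgn ε j * ∑ i, sgn ε i * d i = 2 * d j := fun ε => by
    have hj : sgn (flip ε) j = sgn ε j := by simp [sgn, hf]
    have hsq : sgn ε j * sgn ε j = 1 := by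
      rcases Int.units_eq_one_or (ε j) with h | h <;> simp [sgn, h]
    rw [hj, ← mul_add, ← Finset.sum_add_distrib, Finset.sum_eq_single j]
    · rw [hj]
      linear_combination 2 * d j * hsq
    · intro i _ hi
      simp [sgn, hf, hi]
    · simp
  have : 𝔼 ε : J → ℤˣ, (sgn (flip ε) j * ∑ i, sgn (flip ε) i * d i +
      sgn ε j * ∑ i, sgn ε i * d i) = 2 * d j := by
    simp_rw [hpair]
    exact Fintype.expect_const _
  rw [Finset.expect_add_distrib, hflip] at this
  linarith

/-- Contraction at a single point: one sign in front of `φ` is replaced by independent signs in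
front of the coordinates of `u`, when `φ` is `1`-Lipschitz in `u` for the supremum norm. -/
lemma expect_iSup_add_sgn_le {T J : Type*} [Nonempty T] [Fintype J] [DecidableEq J]
    {a φ : T → ℝ} {u : T → J → ℝ} {A U : ℝ} (ha : ∀ t, |a t| ≤ A) (hu : ∀ t j, |u t j| ≤ U)
    (hφ : ∀ t t', ∃ j, φ t - φ t' ≤ |u t j - u t' j|) :
    𝔼 s : ℤˣ, ⨆ t, (a t + ((s : ℤ) : ℝ) * φ t) ≤
      𝔼 ε : J → ℤˣ, ⨆ t, (a t + ∑ j, sgn ε j * u t j) := by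
  set G : (J → ℤˣ) → ℝ := fun ε => ⨆ t, (a t + ∑ j, sgn ε j * u t j) with hG
  have hle : ∀ ε t, a t + ∑ j, sgn ε j * u t j ≤ G ε := fun ε t => by
    refine le_ciSup (f := fun t => a t + ∑ j, sgn ε j * u t j) ⟨A + ∑ _j : J, U, ?_⟩ t
    rintro _ ⟨t, rfl⟩
    refine add_le_add ((le_abs_self _).trans (ha t)) (Finset.sum_le_sum fun j _ => ?_)
    refine (le_abs_self _).trans ?_
    rw [abs_mul, abs_sgn, one_mul]
    exact hu t j
  have hdouble : 2 * 𝔼 ε, G ε = 𝔼 ε, (G ε + G (-ε)) := by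
    rw [Finset.expect_add_distrib, two_mul]
    congr 1
    exact Fintype.expect_equiv (Equiv.neg _) _ _ fun ε => by simp
  have hpair : ∀ t t', (a t + φ t) + (a t' - φ t') ≤ 2 * 𝔼 ε, G ε := fun t t' => by
    obtain ⟨j, hj⟩ := hφ t t'
    obtain ⟨s, hs1, hs⟩ : ∃ s : ℝ, (s = 1 ∨ s = -1) ∧ |u t j - u t' j| = s * (u t j - u t' j) := by
      rcases abs_choice (u t j - u t' j) with h | h
      · exact ⟨1, Or.inl rfl, by rw [h, one_mul]⟩
      · exact ⟨-1, Or.inr rfl, by rw [h]; ring⟩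
    have hε : ∀ ε : J → ℤˣ, a t + a t' + s * (sgn ε j * ∑ i, sgn ε i * (u t i - u t' i)) ≤
        G ε + G (-ε) := fun ε => by
      have e1 := hle ε t
      have e2 := hle ε t'
      have e3 := hle (-ε) t
      have e4 := hle (-ε) t'
      simp only [sgn_neg, neg_mul, Finset.sum_neg_distrib] at e3 e4
      have hsum : ∑ i, sgn ε i * (u t i - u t' i) =
          ∑ i, sgn ε i * u t i - ∑ i, sgn ε i * u t' i := by
        rw [← Finset.sum_sub_distrib]
        exact Finset.sum_congr rfl fun i _ => by ring
      rw [hsum]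
      have hj1 : sgn ε j = 1 ∨ sgn ε j = -1 := by
        rcases Int.units_eq_one_or (ε j) with h | h <;> simp [sgn, h]
      rcases hs1 with rfl | rfl <;> rcases hj1 with h | h <;> rw [h] <;> linarith
    calc (a t + φ t) + (a t' - φ t') ≤ a t + a t' + s * (u t j - u t' j) := by linarith
      _ = 𝔼 ε : J → ℤˣ, (a t + a t' + s * (sgn ε j * ∑ i, sgn ε i * (u t i - u t' i))) := by
          rw [Finset.expect_add_distrib, ← Finset.mul_expect, expect_sgn_mul_sum,
            Fintype.expect_const]
      _ ≤ 𝔼 ε, (G ε + G (-ε)) := Finset.expect_le_expect fun ε _ => hε ε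
      _ = 2 * 𝔼 ε, G ε := hdouble.symm
  rw [expect_units]
  have h1 : ⨆ t, (a t + ((((1 : ℤˣ) : ℤ) : ℝ)) * φ t) ≤
      2 * 𝔼 ε, G ε - ⨆ t, (a t + ((((-1 : ℤˣ) : ℤ) : ℝ)) * φ t) := by
    refine ciSup_le fun t => le_sub_comm.1 (ciSup_le fun t' => ?_)
    have := hpair t t'
    push_cast
    linarith
  linarith

/-- **Contraction**: the signed sums of `φ` are replaced by signed sums, with independent signs, of
all the coordinates of `u`, when `φ` is, at each point, `1`-Lipschitz in `u` for the supremum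
norm. -/
theorem expect_iSup_sum_le {T J : Type*} [Nonempty T] [Fintype J] [DecidableEq J] {m : ℕ}
    {a : T → ℝ} {φ : T → Fin m → ℝ} {u : T → Fin m → J → ℝ} {A Φ U : ℝ} (ha : ∀ t, |a t| ≤ A)
    (hΦ : ∀ t k, |φ t k| ≤ Φ) (hu : ∀ t k j, |u t k j| ≤ U)
    (hφ : ∀ k t t', ∃ j, φ t k - φ t' k ≤ |u t k j - u t' k j|) :
    𝔼 σ : Fin m → ℤˣ, ⨆ t, (a t + ∑ k, sgn σ k * φ t k) ≤
      𝔼 τ : Fin m → J → ℤˣ, ⨆ t, (a t + ∑ k, ∑ j, sgn (τ k) j * u t k j) := by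
  induction m generalizing a A with
  | zero => simp
  | succ m ih =>
    have hsgn : ∀ (s : ℤˣ) t, |a t + ((s : ℤ) : ℝ) * φ t 0| ≤ A + Φ := fun s t => by
      refine (abs_add_le _ _).trans (add_le_add (ha t) ?_)
      rw [abs_mul, show |((s : ℤ) : ℝ)| = 1 from abs_sgn (fun _ : Unit => s) (), one_mul]
      exact hΦ t 0
    have hsum : ∀ (τ : Fin m → J → ℤˣ) t, |a t + ∑ k, ∑ j, sgn (τ k) j * u t k.succ j| ≤
        A + ∑ _k : Fin m, ∑ _j : J, U := fun τ t => by
      refine (abs_add_le _ _).trans (add_le_add (ha t) ?_)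
      refine (Finset.abs_sum_le_sum_abs _ _).trans (Finset.sum_le_sum fun k _ => ?_)
      refine (Finset.abs_sum_le_sum_abs _ _).trans (Finset.sum_le_sum fun j _ => ?_)
      rw [abs_mul, abs_sgn, one_mul]
      exact hu t _ j
    calc 𝔼 σ : Fin (m + 1) → ℤˣ, ⨆ t, (a t + ∑ k, sgn σ k * φ t k)
        = 𝔼 s : ℤˣ, 𝔼 σ : Fin m → ℤˣ,
            ⨆ t, ((a t + ((s : ℤ) : ℝ) * φ t 0) + ∑ k, sgn σ k * φ t k.succ) := by
          rw [expect_fin_succ]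
          refine Finset.expect_congr rfl fun s _ => Finset.expect_congr rfl fun σ _ =>
            iSup_congr fun t => ?_
          rw [Fin.sum_univ_succ, ← add_assoc]
          simp [sgn]
      _ ≤ 𝔼 s : ℤˣ, 𝔼 τ : Fin m → J → ℤˣ,
            ⨆ t, ((a t + ((s : ℤ) : ℝ) * φ t 0) + ∑ k, ∑ j, sgn (τ k) j * u t k.succ j) :=
          Finset.expect_le_expect fun s _ => ih (hsgn s) (fun t k => hΦ t _)
            (fun t k j => hu t _ j) fun k t t' => hφ _ t t'
      _ = 𝔼 τ : Fin m → J → ℤˣ, 𝔼 s : ℤˣ,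
            ⨆ t, ((a t + ∑ k, ∑ j, sgn (τ k) j * u t k.succ j) + ((s : ℤ) : ℝ) * φ t 0) := by
          rw [Finset.expect_comm]
          refine Finset.expect_congr rfl fun s _ => Finset.expect_congr rfl fun σ _ =>
            iSup_congr fun t => ?_
          ring
      _ ≤ 𝔼 τ : Fin m → J → ℤˣ, 𝔼 ε : J → ℤˣ,
            ⨆ t, ((a t + ∑ k, ∑ j, sgn (τ k) j * u t k.succ j) + ∑ j, sgn ε j * u t 0 j) :=
          Finset.expect_le_expect fun τ _ => expect_iSup_add_sgn_le (hsum τ)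
            (fun t j => hu t 0 j) fun t t' => hφ 0 t t'
      _ = 𝔼 τ : Fin (m + 1) → J → ℤˣ, ⨆ t, (a t + ∑ k, ∑ j, sgn (τ k) j * u t k j) := by
          rw [expect_fin_succ, Finset.expect_comm]
          refine Finset.expect_congr rfl fun s _ => Finset.expect_congr rfl fun σ _ =>
            iSup_congr fun t => ?_
          rw [Fin.sum_univ_succ]
          simp only [Fin.cons_zero, Fin.cons_succ]
          ring

/-- Contraction, stated for the Rademacher complexity: it is bounded by a supremum of signed means
in which each coordinate `j` of `u` has its own signs `fun k => τ k j`. -/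
lemma radComplexity_le_expect {ι J : Type*} [Nonempty ι] [Fintype J] [DecidableEq J] {K : ℕ}
    {φ : ι → Fin K → ℝ} {u : ι → Fin K → J → ℝ} {c U : ℝ} (hc : ∀ i k, |φ i k| ≤ c)
    (hu : ∀ i k j, |u i k j| ≤ U)
    (hφ : ∀ k i i', ∃ j, φ i k - φ i' k ≤ |u i k j - u i' k j|) :
    radComplexity φ ≤
      𝔼 τ : Fin K → J → ℤˣ, ⨆ i, ∑ j, wavg (sgn fun k => τ k j) (fun k => u i k j) := by
  have hK0 : (0 : ℝ) ≤ K := Nat.cast_nonneg K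
  have h := expect_iSup_sum_le (T := ι) (a := fun _ => 0) (A := 0)
    (φ := fun i k => φ i k / K) (u := fun i k j => u i k j / K) (Φ := c / K) (U := U / K)
    (fun _ => by simp)
    (fun i k => by rw [abs_div, Nat.abs_cast]; exact div_le_div_of_nonneg_right (hc i k) hK0)
    (fun i k j => by rw [abs_div, Nat.abs_cast]; exact div_le_div_of_nonneg_right (hu i k j) hK0)
    (fun k i i' => by
      obtain ⟨j, hj⟩ := hφ k i i'
      refine ⟨j, ?_⟩
      rw [← sub_div, ← sub_div, abs_div, Nat.abs_cast]
      exact div_le_div_of_nonneg_right hj hK0)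
  have e1 : radComplexity φ =
      𝔼 σ : Fin K → ℤˣ, ⨆ i, ((0 : ℝ) + ∑ k, sgn σ k * (φ i k / K)) := by
    simp [radComplexity, wavg, Finset.sum_div, mul_div_assoc]
  rw [e1]
  refine h.trans_eq ?_
  refine Finset.expect_congr rfl fun τ _ => iSup_congr fun i => ?_
  rw [Finset.sum_comm, zero_add]
  simp [wavg, sgn, Finset.sum_div, mul_div_assoc]

lemma bddAbove_wavg {X : Type*} {K : ℕ} (hK : 0 < K) {H : Set (X → ℝ)} {x : Fin K → X} {U : ℝ}
    (hU : ∀ h : H, ∀ k, |(h : X → ℝ) (x k)| ≤ U) (σ : Fin K → ℤˣ) :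
    BddAbove (Set.range fun h : H => wavg (sgn σ) fun k => (h : X → ℝ) (x k)) := by
  refine ⟨U, ?_⟩
  rintro _ ⟨h, rfl⟩
  exact (le_abs_self _).trans (abs_wavg_le hK (fun k => (abs_sgn σ k).le) (hU h))

/-- The complexity of a class of functions of tuples of `n` members of `H` that are `L`-Lipschitz
for the supremum norm. -/
theorem radComplexity_le_of_sup_lipschitz {X ι : Type*} [Nonempty ι] {n K : ℕ} (hK : 0 < K)
    {H : Set (X → ℝ)} {x : Fin K → X} {U : ℝ} (hU : ∀ h : H, ∀ k, |(h : X → ℝ) (x k)| ≤ U)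
    (v : ι → Fin n → H) {φ : ι → Fin K → ℝ} {c L : ℝ} (hc : ∀ i k, |φ i k| ≤ c) (hL : 0 ≤ L)
    (hφ : ∀ k i i', ∃ j, φ i k - φ i' k ≤
      L * |(v i j : X → ℝ) (x k) - (v i' j : X → ℝ) (x k)|) :
    radComplexity φ ≤ L * n * rademacher H x := by
  have h := radComplexity_le_expect (u := fun i k j => L * (v i j : X → ℝ) (x k)) (U := L * U) hc
    (fun i k j => by rw [abs_mul, abs_of_nonneg hL]; exact mul_le_mul_of_nonneg_left (hU _ k) hL)
    (fun k i i' => by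
      obtain ⟨j, hj⟩ := hφ k i i'
      exact ⟨j, by rwa [← mul_sub, abs_mul, abs_of_nonneg hL]⟩)
  refine h.trans ?_
  have hstep : ∀ τ : Fin K → Fin n → ℤˣ,
      ⨆ i, ∑ j, wavg (sgn fun k => τ k j) (fun k => L * (v i j : X → ℝ) (x k)) ≤
        ∑ j, L * ⨆ h : H, wavg (sgn fun k => τ k j) fun k => (h : X → ℝ) (x k) := fun τ =>
    ciSup_le fun i => Finset.sum_le_sum fun j _ => by
      have : wavg (sgn fun k => τ k j) (fun k => L * (v i j : X → ℝ) (x k)) =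
          L * wavg (sgn fun k => τ k j) (fun k => (v i j : X → ℝ) (x k)) := by
        rw [wavg, wavg, ← mul_div_assoc, Finset.mul_sum]
        congr 1
        exact Finset.sum_congr rfl fun k _ => by ring
      rw [this]
      exact mul_le_mul_of_nonneg_left (le_ciSup (bddAbove_wavg hK hU _) (v i j)) hL
  refine (Finset.expect_le_expect fun τ _ => hstep τ).trans_eq ?_
  rw [Finset.expect_sum_comm]
  have hj : ∀ j : Fin n, 𝔼 τ : Fin K → Fin n → ℤˣ,
      L * ⨆ h : H, wavg (sgn fun k => τ k j) (fun k => (h : X → ℝ) (x k)) =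
        L * rademacher H x := fun j => by
    rw [← Finset.mul_expect, expect_column (fun σ : Fin K → ℤˣ =>
      ⨆ h : H, wavg (sgn σ) fun k => (h : X → ℝ) (x k)) j, rademacher_eq, radComplexity]
  simp only [hj, Finset.sum_const, Finset.card_univ, Fintype.card_fin, nsmul_eq_mul]
  ring

/-- The complexity of a class of functions of tuples of `n` members of `H` that are
`1`-Lipschitz in the sum of the tuple. -/
theorem radComplexity_le_of_sum_lipschitz {X ι : Type*} [Nonempty ι] {n K : ℕ} (hK : 0 < K)
    {H : Set (X → ℝ)} {x : Fin K → X} {U : ℝ} (hU : ∀ h : H, ∀ k, |(h : X → ℝ) (x k)| ≤ U)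
    (v : ι → Fin n → H) {φ : ι → Fin K → ℝ} {c : ℝ} (hc : ∀ i k, |φ i k| ≤ c)
    (hφ : ∀ k i i', φ i k - φ i' k ≤
      |∑ j, (v i j : X → ℝ) (x k) - ∑ j, (v i' j : X → ℝ) (x k)|) :
    radComplexity φ ≤ n * rademacher H x := by
  have h := radComplexity_le_expect (J := Unit) (u := fun i k _ => ∑ j, (v i j : X → ℝ) (x k))
    (U := ∑ _j : Fin n, U) hc
    (fun i k _ => (Finset.abs_sum_le_sum_abs _ _).trans (Finset.sum_le_sum fun j _ => hU _ k))
    (fun k i i' => ⟨(), hφ k i i'⟩)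
  refine h.trans ?_
  simp only [Finset.univ_unique, Finset.sum_singleton]
  rw [expect_column (J := Unit) (fun σ : Fin K → ℤˣ =>
      ⨆ i, wavg (sgn σ) fun k => ∑ j, (v i j : X → ℝ) (x k)) (), rademacher_eq, radComplexity,
    Finset.mul_expect]
  refine Finset.expect_le_expect fun σ _ => ciSup_le fun i => ?_
  have : wavg (sgn σ) (fun k => ∑ j, (v i j : X → ℝ) (x k)) =
      ∑ j, wavg (sgn σ) fun k => (v i j : X → ℝ) (x k) := by
    simp only [wavg, ← Finset.sum_div, Finset.mul_sum]
    rw [Finset.sum_comm]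
  rw [this]
  calc _ ≤ ∑ _j : Fin n, ⨆ h : H, wavg (sgn σ) fun k => (h : X → ℝ) (x k) :=
        Finset.sum_le_sum fun j _ => le_ciSup (bddAbove_wavg hK hU σ) (v i j)
    _ = _ := by simp

lemma radComplexity_add_le {ι : Type*} [Nonempty ι] {K : ℕ} (hK : 0 < K) {φ φ' : ι → Fin K → ℝ}
    {c c' : ℝ} (hc : ∀ i k, |φ i k| ≤ c) (hc' : ∀ i k, |φ' i k| ≤ c') :
    radComplexity (fun i k => φ i k + φ' i k) ≤ radComplexity φ + radComplexity φ' := by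
  simp only [radComplexity]
  rw [← Finset.expect_add_distrib]
  refine Finset.expect_le_expect fun σ _ => ciSup_le fun i => ?_
  have hb : ∀ {ψ : ι → Fin K → ℝ} {d : ℝ}, (∀ i k, |ψ i k| ≤ d) →
      BddAbove (Set.range fun i => wavg (sgn σ) (ψ i)) := fun {ψ d} hd => by
    refine ⟨d, ?_⟩
    rintro _ ⟨i, rfl⟩
    exact (le_abs_self _).trans (abs_wavg_le hK (fun k => (abs_sgn σ k).le) (hd i))
  have hw : wavg (sgn σ) (fun k => φ i k + φ' i k) =
      wavg (sgn σ) (φ i) + wavg (sgn σ) (φ' i) := by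
    simp only [wavg, ← add_div, ← Finset.sum_add_distrib, mul_add]
  rw [hw]
  exact add_le_add (le_ciSup (hb hc) i) (le_ciSup (hb hc') i)

/-! ### The losses -/

lemma l1_nonneg {n : ℕ} (v : Fin n → ℝ) : 0 ≤ l1 v := Finset.sum_nonneg fun _ _ => abs_nonneg _

lemma l1_eq_sum {n : ℕ} {v : Fin n → ℝ} (hv : ∀ i, 0 ≤ v i) : l1 v = ∑ i, v i :=
  Finset.sum_congr rfl fun i _ => abs_of_nonneg (hv i)

lemma l1_add_le {n : ℕ} (v w : Fin n → ℝ) : l1 (v + w) ≤ l1 v + l1 w := by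
  rw [l1, l1, l1, ← Finset.sum_add_distrib]
  exact Finset.sum_le_sum fun i _ => abs_add_le _ _

lemma l1_sub_comm {n : ℕ} (v w : Fin n → ℝ) : l1 (v - w) = l1 (w - v) :=
  Finset.sum_congr rfl fun _ _ => abs_sub_comm _ _

@[fun_prop]
lemma continuous_l1 {n : ℕ} : Continuous (l1 : (Fin n → ℝ) → ℝ) := by
  unfold l1; fun_prop

lemma measurable_l1 {n : ℕ} : Measurable (l1 : (Fin n → ℝ) → ℝ) := continuous_l1.measurable

lemma measurable_normalize {n : ℕ} : Measurable (normalize : (Fin n → ℝ) → Fin n → ℝ) :=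
  measurable_pi_iff.2 fun i => (measurable_pi_apply i).div measurable_l1

lemma normalize_nonneg {n : ℕ} {v : Fin n → ℝ} (hv : ∀ i, 0 ≤ v i) (i : Fin n) :
    0 ≤ normalize v i := div_nonneg (hv i) (l1_nonneg v)

lemma sum_normalize {n : ℕ} {v : Fin n → ℝ} (hv : ∀ i, 0 ≤ v i) (h1 : 1 ≤ l1 v) :
    ∑ i, normalize v i = 1 := by
  simp only [normalize]
  rw [← Finset.sum_div, ← l1_eq_sum hv, div_self (by linarith)]

lemma tendsto_half_l1_normalize_sub {n : ℕ} {α : Type*} {F : Filter α} {v : α → Fin n → ℝ}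
    {w : Fin n → ℝ} (h : Tendsto v F (𝓝 w)) (hw : 1 ≤ l1 w) :
    Tendsto (fun a => (1 / 2) * l1 (normalize (v a) - normalize w)) F (𝓝 0) := by
  have hl : Tendsto (fun a => l1 (v a)) F (𝓝 (l1 w)) := (continuous_l1.tendsto w).comp h
  have hn : Tendsto (fun a => normalize (v a)) F (𝓝 (normalize w)) := by
    rw [tendsto_pi_nhds] at h ⊢
    exact fun i => (h i).div hl (by linarith)
  have := ((continuous_l1.tendsto _).comp (hn.sub_const (normalize w))).const_mul (1 / 2)
  simpa [l1] using this

lemma lossC_nonneg {n : ℕ} (z x : Fin n → ℝ) : 0 ≤ lossC z x := abs_nonneg _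

lemma lossC_sub_le {n : ℕ} (z : Fin n → ℝ) {x y : Fin n → ℝ} (hx : ∀ i, 0 ≤ x i)
    (hy : ∀ i, 0 ≤ y i) : lossC z x - lossC z y ≤ |∑ i, x i - ∑ i, y i| := by
  rw [lossC, lossC, ← l1_eq_sum hx, ← l1_eq_sum hy]
  refine (abs_sub_abs_le_abs_sub _ _).trans_eq ?_
  rw [sub_sub_sub_cancel_left, abs_sub_comm]

lemma lossTV_nonneg {n : ℕ} (z x : Fin n → ℝ) : 0 ≤ lossTV z x :=
  mul_nonneg (by norm_num) (l1_nonneg _)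

lemma lossTV_le_one {n : ℕ} {z x : Fin n → ℝ} (hz : ∀ i, 0 ≤ z i) (hz1 : 1 ≤ l1 z)
    (hx : ∀ i, 0 ≤ x i) (hx1 : 1 ≤ l1 x) : lossTV z x ≤ 1 := by
  have h : l1 (normalize z - normalize x) ≤ ∑ i, (normalize z i + normalize x i) :=
    Finset.sum_le_sum fun i _ => by
      have a := normalize_nonneg hz i
      have b := normalize_nonneg hx i
      exact abs_le.2 ⟨by simp only [Pi.sub_apply]; linarith, by
        simp only [Pi.sub_apply]; linarith⟩
  rw [Finset.sum_add_distrib, sum_normalize hz hz1, sum_normalize hx hx1] at h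
  rw [lossTV]
  linarith

lemma lossTV_sub_le {n : ℕ} (z x y : Fin n → ℝ) :
    lossTV z x - lossTV z y ≤ (1 / 2) * l1 (normalize x - normalize y) := by
  have h := l1_add_le (normalize z - normalize y) (normalize y - normalize x)
  rw [sub_add_sub_cancel, l1_sub_comm (normalize y)] at h
  rw [lossTV, lossTV]
  linarith

/-- The total variation distance of the normalized vectors is `n / 2`-Lipschitz for the supremum
norm, on the vectors all of whose entries are at least `1 / n`. The lower bound on the entries is
what keeps the constant this small: near a vertex of the simplex the normalization is
steeper. -/
lemma half_l1_normalize_sub_le {n : ℕ} {x y : Fin n → ℝ} (hn : 0 < n) {M : ℝ}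
    (hx : ∀ i, 1 / (n : ℝ) ≤ x i) (hy : ∀ i, 1 / (n : ℝ) ≤ y i) (hM : ∀ i, |x i - y i| ≤ M) :
    (1 / 2) * l1 (normalize x - normalize y) ≤ n / 2 * M := by
  wlog hle : l1 x ≤ l1 y generalizing x y
  · rw [l1_sub_comm]
    exact this hy hx (fun i => by rw [abs_sub_comm]; exact hM i) (le_of_not_ge hle)
  have hn' : (0 : ℝ) < n := Nat.cast_pos.2 hn
  have hge : ∀ {x : Fin n → ℝ}, (∀ i, 1 / (n : ℝ) ≤ x i) → (∀ i, 0 ≤ x i) ∧ 1 ≤ l1 x := by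
    intro x hx
    have h0 : ∀ i, 0 ≤ x i := fun i => le_trans (by positivity) (hx i)
    refine ⟨h0, ?_⟩
    rw [l1_eq_sum h0]
    calc (1 : ℝ) = ∑ _i : Fin n, 1 / (n : ℝ) := by simp [hn'.ne']
      _ ≤ _ := Finset.sum_le_sum fun i _ => hx i
  obtain ⟨hx0, hx1⟩ := hge hx
  obtain ⟨hy0, hy1⟩ := hge hy
  have hM0 : 0 ≤ M := (abs_nonneg _).trans (hM ⟨0, hn⟩)
  -- the set on which `normalize x` exceeds `normalize y` attains the total variation
  set A : Finset (Fin n) := Finset.univ.filter fun i => normalize y i ≤ normalize x i with hA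
  set A' : Finset (Fin n) := Finset.univ.filter fun i => ¬ normalize y i ≤ normalize x i with hA'
  have hsplit : ∀ w : Fin n → ℝ, ∑ i ∈ A, w i + ∑ i ∈ A', w i = ∑ i, w i := fun w =>
    Finset.sum_filter_add_sum_filter_not _ _ _
  have hl : l1 (normalize x - normalize y) =
      ∑ i ∈ A, (normalize x i - normalize y i) + ∑ i ∈ A', -(normalize x i - normalize y i) := by
    rw [l1, ← hsplit]
    congr 1 <;> refine Finset.sum_congr rfl fun i hi => ?_
    · exact abs_of_nonneg (sub_nonneg.2 (Finset.mem_filter.1 hi).2)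
    · exact abs_of_neg (sub_neg.2 (not_le.1 (Finset.mem_filter.1 hi).2))
  have hzero : ∑ i ∈ A, (normalize x i - normalize y i) +
      ∑ i ∈ A', (normalize x i - normalize y i) = 0 := by
    rw [hsplit, Finset.sum_sub_distrib, sum_normalize hx0 hx1, sum_normalize hy0 hy1, sub_self]
  have htv : (1 / 2) * l1 (normalize x - normalize y) =
      (∑ i ∈ A, x i) / l1 x - (∑ i ∈ A, y i) / l1 y := by
    rw [Finset.sum_neg_distrib] at hl
    rw [hl, Finset.sum_div, Finset.sum_div, ← Finset.sum_sub_distrib]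
    simp only [normalize] at hzero ⊢
    linarith
  have hsx : l1 x = ∑ i ∈ A, x i + ∑ i ∈ A', x i := by rw [hsplit, l1_eq_sum hx0]
  have hsy : l1 y = ∑ i ∈ A, y i + ∑ i ∈ A', y i := by rw [hsplit, l1_eq_sum hy0]
  have hcard : ∀ s : Finset (Fin n), (s.card : ℝ) ≤ n * ∑ i ∈ s, x i := fun s => by
    have : ∑ _i ∈ s, 1 / (n : ℝ) ≤ ∑ i ∈ s, x i := Finset.sum_le_sum fun i _ => hx i
    rw [Finset.sum_const, nsmul_eq_mul, mul_one_div, div_le_iff₀ hn'] at this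
    linarith
  have hdiff : ∀ s : Finset (Fin n), |∑ i ∈ s, x i - ∑ i ∈ s, y i| ≤ s.card * M := fun s => by
    rw [← Finset.sum_sub_distrib, ← nsmul_eq_mul, ← Finset.sum_const]
    exact (Finset.abs_sum_le_sum_abs _ _).trans (Finset.sum_le_sum fun i _ => hM i)
  have hpos : ∀ s : Finset (Fin n), 0 ≤ ∑ i ∈ s, x i := fun s =>
    Finset.sum_nonneg fun i _ => hx0 i
  have c1 := hcard A
  have c2 := hcard A'
  have d1 := abs_le.1 (hdiff A)
  have d2 := abs_le.1 (hdiff A')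
  have p1 := hpos A
  have p2 := hpos A'
  rw [htv, div_sub_div _ _ (by linarith) (by linarith),
    div_le_iff₀ (mul_pos (by linarith) (by linarith))]
  generalize ∑ i ∈ A, x i = u at *
  generalize ∑ i ∈ A', x i = v at *
  generalize ∑ i ∈ A, y i = u' at *
  generalize ∑ i ∈ A', y i = v' at *
  have e1 : u * l1 y - l1 x * u' = u * (v' - v) + v * (u - u') := by rw [hsx, hsy]; ring
  have e2 : u * (v' - v) + v * (u - u') ≤ u * (n * v * M) + v * (n * u * M) :=
    add_le_add
      (mul_le_mul_of_nonneg_left (by nlinarith [mul_le_mul_of_nonneg_right c2 hM0]) p1)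
      (mul_le_mul_of_nonneg_left (by nlinarith [mul_le_mul_of_nonneg_right c1 hM0]) p2)
  have e3 : u * (n * v * M) + v * (n * u * M) ≤ n / 2 * M * (l1 x * l1 x) := by
    rw [hsx]
    nlinarith [mul_nonneg (mul_nonneg hn'.le hM0) (sq_nonneg (u - v))]
  have e4 : n / 2 * M * (l1 x * l1 x) ≤ n / 2 * M * (l1 x * l1 y) :=
    mul_le_mul_of_nonneg_left (mul_le_mul_of_nonneg_left hle (l1_nonneg _)) (by positivity)
  linarith

/-! ### The optimal transport cost -/

lemma maxCost_nonneg {n : ℕ} {C : Fin n → Fin n → ℝ} (hC : ∀ i j, 0 ≤ C i j) : 0 ≤ maxCost C :=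
  Real.iSup_nonneg fun p => hC p.1 p.2

lemma le_maxCost {n : ℕ} (C : Fin n → Fin n → ℝ) (i j : Fin n) : C i j ≤ maxCost C :=
  le_ciSup (f := fun p : Fin n × Fin n => C p.1 p.2) (Set.finite_range _).bddAbove (i, j)

lemma transportCost_nonneg {n : ℕ} {C : Fin n → Fin n → ℝ} (hC : ∀ i j, 0 ≤ C i j)
    {μ ν : Fin n → ℝ} {γ : Fin n → Fin n → ℝ} (hγ : γ ∈ transportPlans μ ν) :
    0 ≤ ∑ i, ∑ j, C i j * γ i j :=
  Finset.sum_nonneg fun i _ => Finset.sum_nonneg fun j _ => mul_nonneg (hC i j) (hγ.1 i j)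

lemma otCost_nonneg {n : ℕ} {C : Fin n → Fin n → ℝ} (hC : ∀ i j, 0 ≤ C i j)
    (μ ν : Fin n → ℝ) : 0 ≤ otCost C μ ν := by
  refine Real.sInf_nonneg ?_
  rintro _ ⟨γ, hγ, rfl⟩
  exact transportCost_nonneg hC hγ

lemma otCost_le {n : ℕ} {C : Fin n → Fin n → ℝ} (hC : ∀ i j, 0 ≤ C i j)
    {μ ν : Fin n → ℝ} {γ : Fin n → Fin n → ℝ} (hγ : γ ∈ transportPlans μ ν) :
    otCost C μ ν ≤ ∑ i, ∑ j, C i j * γ i j := by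
  refine csInf_le ⟨0, ?_⟩ ⟨γ, hγ, rfl⟩
  rintro _ ⟨γ, hγ, rfl⟩
  exact transportCost_nonneg hC hγ

lemma mul_mem_transportPlans {n : ℕ} {μ ν : Fin n → ℝ} (hμ : ∀ i, 0 ≤ μ i) (hμ1 : ∑ i, μ i = 1)
    (hν : ∀ i, 0 ≤ ν i) (hν1 : ∑ i, ν i = 1) : (fun i j => μ i * ν j) ∈ transportPlans μ ν :=
  ⟨fun i j => mul_nonneg (hμ i) (hν j), fun i => by rw [← Finset.mul_sum, hν1, mul_one],
    fun j => by rw [← Finset.sum_mul, hμ1, one_mul]⟩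

lemma otCost_le_of_le {n : ℕ} {C : Fin n → Fin n → ℝ} (hC : ∀ i j, 0 ≤ C i j) {c : ℝ}
    (hc : ∀ i j, C i j ≤ c) {μ ν : Fin n → ℝ} (hμ : ∀ i, 0 ≤ μ i) (hμ1 : ∑ i, μ i = 1)
    (hν : ∀ i, 0 ≤ ν i) (hν1 : ∑ i, ν i = 1) : otCost C μ ν ≤ c := by
  refine (otCost_le hC (mul_mem_transportPlans hμ hμ1 hν hν1)).trans ?_
  calc _ ≤ ∑ i, ∑ j, c * (μ i * ν j) := Finset.sum_le_sum fun i _ => Finset.sum_le_sum fun j _ =>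
        mul_le_mul_of_nonneg_right (hc i j) (mul_nonneg (hμ i) (hν j))
    _ = c := by simp_rw [← Finset.mul_sum]; rw [hν1]; simp [hμ1]

/-- The transport cost grows by at most `c` times the total variation distance when the target
`ν` is replaced by `ν'`, if the entries of the cost matrix lie in `[0, c]`. A plan to `ν` is
scaled down to the part of each column that `ν` and `ν'` have in common, and the mass that this
sets free is distributed over the columns in which `ν'` has more mass. -/
lemma otCost_le_add_right {n : ℕ} {C : Fin n → Fin n → ℝ} (hC : ∀ i j, 0 ≤ C i j) {c : ℝ}
    (hc : ∀ i j, C i j ≤ c) {μ ν ν' : Fin n → ℝ} (hμ : ∀ i, 0 ≤ μ i) (hμ1 : ∑ i, μ i = 1)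
    (hν : ∀ i, 0 ≤ ν i) (hν1 : ∑ i, ν i = 1) (hν' : ∀ i, 0 ≤ ν' i) (hν1' : ∑ i, ν' i = 1) :
    otCost C μ ν' ≤ otCost C μ ν + c * ((1 / 2) * l1 (ν - ν')) := by
  rw [← sub_le_iff_le_add]
  refine le_csInf ⟨_, _, mul_mem_transportPlans hμ hμ1 hν hν1, rfl⟩ ?_
  rintro _ ⟨γ, ⟨hγ0, hγr, hγc⟩, rfl⟩
  rw [sub_le_iff_le_add]
  set m : Fin n → ℝ := fun j => min (ν j) (ν' j) with hm
  have hm0 : ∀ j, 0 ≤ m j := fun j => le_min (hν j) (hν' j)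
  have hmν : ∀ j, m j / ν j * ν j = m j := fun j => by
    by_cases h : ν j = 0
    · have : m j = 0 := le_antisymm ((min_le_left _ _).trans h.le) (hm0 j)
      rw [h, this]; simp
    · field_simp
  have hr1 : ∀ j, m j / ν j ≤ 1 := fun j => div_le_one_of_le₀ (min_le_left _ _) (hν j)
  have hr0 : ∀ j, 0 ≤ m j / ν j := fun j => div_nonneg (hm0 j) (hν j)
  set e : Fin n → ℝ := fun j => ν' j - m j with he
  set r : Fin n → ℝ := fun i => μ i - ∑ j, γ i j * (m j / ν j) with hr
  set T : ℝ := ∑ j, e j with hT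
  have he0 : ∀ j, 0 ≤ e j := fun j => sub_nonneg.2 (min_le_right _ _)
  have hrn : ∀ i, 0 ≤ r i := fun i => by
    simp only [hr]
    rw [← hγr i, ← Finset.sum_sub_distrib]
    exact Finset.sum_nonneg fun j _ => by nlinarith [hγ0 i j, hr1 j]
  have hrT : ∑ i, r i = T := by
    simp only [hr, hT, he]
    rw [Finset.sum_sub_distrib, Finset.sum_sub_distrib, hμ1, hν1', Finset.sum_comm]
    congr 1
    refine Finset.sum_congr rfl fun j _ => ?_
    rw [← Finset.sum_mul, hγc j, mul_comm, hmν]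
  have hT0 : 0 ≤ T := Finset.sum_nonneg fun j _ => he0 j
  have hTl : T = (1 / 2) * l1 (ν - ν') := by
    have habs : ∀ j, |(ν - ν') j| = ν j + ν' j - 2 * m j := fun j => by
      simp only [hm, Pi.sub_apply]
      rcases le_total (ν j) (ν' j) with h | h
      · rw [min_eq_left h, abs_of_nonpos (by linarith)]; ring
      · rw [min_eq_right h, abs_of_nonneg (by linarith)]; ring
    simp only [l1, habs, hT, he]
    rw [Finset.sum_sub_distrib, Finset.sum_sub_distrib, Finset.sum_add_distrib, ← Finset.mul_sum,
      hν1, hν1']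
    ring
  -- if no mass has to be moved then `T = 0`, and the added term `0 / 0` vanishes, as it should
  have hTdiv : ∀ i, T = 0 → r i = 0 ∧ e i = 0 := fun i h =>
    ⟨(Finset.sum_eq_zero_iff_of_nonneg fun i _ => hrn i).1 (hrT.trans h) i (Finset.mem_univ i),
      (Finset.sum_eq_zero_iff_of_nonneg fun i _ => he0 i).1 h i (Finset.mem_univ i)⟩
  have hrTT : ∀ i, r i * T / T = r i := fun i => by
    by_cases h : T = 0
    · rw [h, (hTdiv i h).1]; simp
    · field_simp
  have heTT : ∀ i, T * e i / T = e i := fun i => by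
    by_cases h : T = 0
    · rw [h, (hTdiv i h).2]; simp
    · field_simp
  have hplan : (fun i j => γ i j * (m j / ν j) + r i * e j / T) ∈ transportPlans μ ν' := by
    refine ⟨fun i j => add_nonneg (mul_nonneg (hγ0 i j) (hr0 j))
      (div_nonneg (mul_nonneg (hrn i) (he0 j)) hT0), fun i => ?_, fun j => ?_⟩
    · rw [Finset.sum_add_distrib, ← Finset.sum_div, ← Finset.mul_sum, ← hT, hrTT]
      simp [hr]
    · rw [Finset.sum_add_distrib, ← Finset.sum_div, ← Finset.sum_mul, ← Finset.sum_mul, hrT, heTT,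
        hγc j, mul_comm, hmν]
      simp [he]
  refine (otCost_le hC hplan).trans ?_
  calc ∑ i, ∑ j, C i j * (γ i j * (m j / ν j) + r i * e j / T)
      ≤ ∑ i, ∑ j, (C i j * γ i j + c * (r i * e j / T)) :=
        Finset.sum_le_sum fun i _ => Finset.sum_le_sum fun j _ => by
          rw [mul_add]
          refine add_le_add (mul_le_mul_of_nonneg_left
            (mul_le_of_le_one_right (hγ0 i j) (hr1 j)) (hC i j)) ?_
          exact mul_le_mul_of_nonneg_right (hc i j)
            (div_nonneg (mul_nonneg (hrn i) (he0 j)) hT0)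
    _ = ∑ i, ∑ j, C i j * γ i j + c * T := by
        have hrow : ∀ i, ∑ j, c * (r i * e j / T) = c * r i := fun i => by
          rw [← Finset.mul_sum, ← Finset.sum_div, ← Finset.mul_sum, ← hT, hrTT]
        simp_rw [Finset.sum_add_distrib, hrow]
        rw [← Finset.mul_sum, hrT]
    _ = _ := by rw [hTl]

lemma otCost_transpose {n : ℕ} (C : Fin n → Fin n → ℝ) (μ ν : Fin n → ℝ) :
    otCost (fun i j => C j i) ν μ = otCost C μ ν := by
  unfold otCost
  congr 1
  ext a
  constructor
  · rintro ⟨γ, ⟨h0, h1, h2⟩, rfl⟩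
    exact ⟨fun i j => γ j i, ⟨fun i j => h0 j i, h2, h1⟩, Finset.sum_comm⟩
  · rintro ⟨γ, ⟨h0, h1, h2⟩, rfl⟩
    exact ⟨fun i j => γ j i, ⟨fun i j => h0 j i, h2, h1⟩, Finset.sum_comm⟩

lemma otCost_le_add {n : ℕ} {C : Fin n → Fin n → ℝ} (hC : ∀ i j, 0 ≤ C i j) {c : ℝ}
    (hc : ∀ i j, C i j ≤ c) {μ μ' ν ν' : Fin n → ℝ} (hμ : μ ∈ stdSimplex ℝ (Fin n))
    (hμ' : μ' ∈ stdSimplex ℝ (Fin n)) (hν : ν ∈ stdSimplex ℝ (Fin n))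
    (hν' : ν' ∈ stdSimplex ℝ (Fin n)) :
    otCost C μ' ν' ≤ otCost C μ ν + c * ((1 / 2) * l1 (μ - μ') + (1 / 2) * l1 (ν - ν')) := by
  have h1 := otCost_le_add_right hC hc hμ.1 hμ.2 hν.1 hν.2 hν'.1 hν'.2
  have h2 := otCost_le_add_right (C := fun i j => C j i) (fun i j => hC j i) (fun i j => hc j i)
    hν'.1 hν'.2 hμ.1 hμ.2 hμ'.1 hμ'.2
  rw [otCost_transpose C μ' ν', otCost_transpose C μ ν'] at h2
  linarith

lemma continuousOn_otCost {n : ℕ} {C : Fin n → Fin n → ℝ} (hC : ∀ i j, 0 ≤ C i j) :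
    ContinuousOn (fun p : (Fin n → ℝ) × (Fin n → ℝ) => otCost C p.1 p.2)
      (stdSimplex ℝ (Fin n) ×ˢ stdSimplex ℝ (Fin n)) := by
  intro q hq
  have hcont : Continuous fun p : (Fin n → ℝ) × (Fin n → ℝ) =>
      maxCost C * ((1 / 2) * l1 (p.1 - q.1) + (1 / 2) * l1 (p.2 - q.2)) := by fun_prop
  have hlim : Tendsto (fun p : (Fin n → ℝ) × (Fin n → ℝ) =>
      maxCost C * ((1 / 2) * l1 (p.1 - q.1) + (1 / 2) * l1 (p.2 - q.2)))
      (𝓝[stdSimplex ℝ (Fin n) ×ˢ stdSimplex ℝ (Fin n)] q) (𝓝 0) := by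
    have := (hcont.tendsto q).mono_left
      (nhdsWithin_le_nhds (s := stdSimplex ℝ (Fin n) ×ˢ stdSimplex ℝ (Fin n)))
    simpa [l1] using this
  refine tendsto_iff_dist_tendsto_zero.2 (squeeze_zero' (Eventually.of_forall fun _ => dist_nonneg)
    ?_ hlim)
  filter_upwards [self_mem_nhdsWithin] with p hp
  have h1 := otCost_le_add hC (le_maxCost C) hp.1 hq.1 hp.2 hq.2
  have h2 := otCost_le_add hC (le_maxCost C) hq.1 hp.1 hq.2 hp.2
  rw [l1_sub_comm q.1, l1_sub_comm q.2] at h2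
  rw [Real.dist_eq, abs_le]
  constructor <;> linarith

lemma normalize_mem_stdSimplex {n : ℕ} {v : Fin n → ℝ} (hv : ∀ i, 0 ≤ v i) (h1 : 1 ≤ l1 v) :
    normalize v ∈ stdSimplex ℝ (Fin n) := ⟨normalize_nonneg hv, sum_normalize hv h1⟩

lemma exists_measurable_eq_otCost {n : ℕ} {C : Fin n → Fin n → ℝ} (hC : ∀ i j, 0 ≤ C i j) :
    ∃ W : (Fin n → ℝ) × (Fin n → ℝ) → ℝ, Measurable W ∧
      ∀ μ ∈ stdSimplex ℝ (Fin n), ∀ ν ∈ stdSimplex ℝ (Fin n), W (μ, ν) = otCost C μ ν := by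
  classical
  have hs : MeasurableSet (stdSimplex ℝ (Fin n) ×ˢ stdSimplex ℝ (Fin n)) :=
    ((isClosed_stdSimplex ℝ (Fin n)).prod (isClosed_stdSimplex ℝ (Fin n))).measurableSet
  refine ⟨_, (continuousOn_otCost hC).measurable_piecewise
    (g := fun _ => 0) continuousOn_const hs, fun μ hμ ν hν => ?_⟩
  exact Set.piecewise_eq_of_mem _ _ _ (Set.mk_mem_prod hμ hν)

lemma lossOT_nonneg {n : ℕ} {C : Fin n → Fin n → ℝ} (hC : ∀ i j, 0 ≤ C i j)
    (z x : Fin n → ℝ) : 0 ≤ lossOT C z x := otCost_nonneg hC _ _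

lemma lossOT_le_maxCost {n : ℕ} {C : Fin n → Fin n → ℝ} (hC : ∀ i j, 0 ≤ C i j)
    {z x : Fin n → ℝ} (hz : ∀ i, 0 ≤ z i) (hz1 : 1 ≤ l1 z) (hx : ∀ i, 0 ≤ x i)
    (hx1 : 1 ≤ l1 x) : lossOT C z x ≤ maxCost C :=
  otCost_le_of_le hC (le_maxCost C) (normalize_nonneg hz) (sum_normalize hz hz1)
    (normalize_nonneg hx) (sum_normalize hx hx1)

lemma lossOT_sub_le {n : ℕ} {C : Fin n → Fin n → ℝ} (hC : ∀ i j, 0 ≤ C i j)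
    {z x y : Fin n → ℝ} (hz : ∀ i, 0 ≤ z i) (hz1 : 1 ≤ l1 z) (hx : ∀ i, 0 ≤ x i)
    (hx1 : 1 ≤ l1 x) (hy : ∀ i, 0 ≤ y i) (hy1 : 1 ≤ l1 y) :
    lossOT C z x - lossOT C z y ≤ maxCost C * ((1 / 2) * l1 (normalize x - normalize y)) := by
  have := otCost_le_add_right hC (le_maxCost C) (normalize_nonneg hz) (sum_normalize hz hz1)
    (normalize_nonneg hy) (sum_normalize hy hy1) (normalize_nonneg hx) (sum_normalize hx hx1)
  rw [l1_sub_comm] at this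
  rw [lossOT, lossOT]
  linarith

/-! ### Pointwise dense subclasses and empirical risk minimization -/

/-- The map whose coordinates are the members `i 0, i 1, …` of `G`. -/
def tupleMap {X : Type*} {n : ℕ} {G : Set (X → ℝ)} (i : Fin n → G) : X → Fin n → ℝ :=
  fun x j => (i j : X → ℝ) x

lemma tupleMap_mem {X : Type*} {n : ℕ} {G H : Set (X → ℝ)} (hGH : G ⊆ H) (i : Fin n → G) :
    tupleMap i ∈ mapSpace H n := fun j => hGH (i j).2

/-- `G` is pointwise sequentially dense in `H`. -/
def IsPointwiseDense {X : Type*} (G H : Set (X → ℝ)) : Prop :=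
  G ⊆ H ∧ ∀ h ∈ H, ∃ g : ℕ → X → ℝ, (∀ m, g m ∈ G) ∧
    ∀ x, Tendsto (fun m => g m x) atTop (𝓝 (h x))

lemma IsPointwiseDense.exists_tupleMap {X : Type*} {n : ℕ} {G H : Set (X → ℝ)}
    (hG : IsPointwiseDense G H) {f : X → Fin n → ℝ} (hf : f ∈ mapSpace H n) :
    ∃ i : ℕ → Fin n → G, ∀ x, Tendsto (fun m => tupleMap (i m) x) atTop (𝓝 (f x)) := by
  choose g hg hlim using fun j => hG.2 _ (hf j)
  exact ⟨fun m j => ⟨g j m, hg j m⟩, fun x => tendsto_pi_nhds.2 fun j => hlim j x⟩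

lemma measurable_of_mem_mapSpace {X : Type*} [MeasurableSpace X] {n : ℕ} {H : Set (X → ℝ)}
    (hHmeas : ∀ h ∈ H, Measurable h) {f : X → Fin n → ℝ} (hf : f ∈ mapSpace H n) :
    Measurable f := measurable_pi_iff.2 fun j => hHmeas _ (hf j)

/-- The excess risk bound for empirical risk minimization over `H × ⋯ × H`, for a loss with values
in `[0, c]` on an almost sure set `Ω₀`. The loss has to be continuous along pointwise convergent
sequences, so that suprema may be taken over tuples from the countable set `G`, and `ρ` relates its
Rademacher complexity to that of `H`. All minimizers of the expected risk have the same risk, so one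
of them, whose deviation is controlled along with that of the class, serves for all. -/
theorem exists_event_risk_le {X : Type*} [MeasurableSpace X] {n K : ℕ} (hK : 0 < K)
    (D : Measure (X × (Fin n → ℝ))) [IsProbabilityMeasure D] {G H : Set (X → ℝ)}
    (hG : IsPointwiseDense G H) (hGc : G.Countable) (hGne : G.Nonempty)
    {Ω₀ : Set (X × (Fin n → ℝ))} (hΩm : MeasurableSet Ω₀) (hΩ : ∀ᵐ p ∂D, p ∈ Ω₀)
    {ℓ : (Fin n → ℝ) → (Fin n → ℝ) → ℝ} {c ρ : ℝ}
    (h0 : ∀ f ∈ mapSpace H n, ∀ p ∈ Ω₀, 0 ≤ ℓ p.2 (f p.1))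
    (hc : ∀ f ∈ mapSpace H n, ∀ p ∈ Ω₀, ℓ p.2 (f p.1) ≤ c)
    (hm : ∀ f ∈ mapSpace H n, ∃ ψ : X × (Fin n → ℝ) → ℝ, Measurable ψ ∧
      ∀ p ∈ Ω₀, ψ p = ℓ p.2 (f p.1))
    (hlim : ∀ p ∈ Ω₀, ∀ f ∈ mapSpace H n, ∀ g : ℕ → X → Fin n → ℝ, (∀ m, g m ∈ mapSpace H n) →
      Tendsto (fun m => g m p.1) atTop (𝓝 (f p.1)) →
        Tendsto (fun m => ℓ p.2 (g m p.1)) atTop (𝓝 (ℓ p.2 (f p.1))))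
    (hrad : ∀ S : Fin K → X × (Fin n → ℝ), (∀ k, S k ∈ Ω₀) →
      radComplexity (fun (i : Fin n → G) k => ℓ (S k).2 (tupleMap i (S k).1)) ≤
        ρ * rademacher H (fun k => (S k).1))
    {δ : ℝ} (hδ0 : 0 < δ) (hδ1 : δ < 1) :
    ∃ E : Set (Fin K → X × (Fin n → ℝ)), MeasurableSet E ∧
      ENNReal.ofReal (1 - δ / 4) ≤ Measure.pi (fun _ : Fin K => D) E ∧
      ∀ S ∈ E, ∀ fS fD : X → Fin n → ℝ,
        IsMinimizer (mapSpace H n) (empRisk S ℓ) fS →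
        IsMinimizer (mapSpace H n) (risk D ℓ) fD →
        risk D ℓ fS ≤ risk D ℓ fD + 2 * (ρ * rademacher H (fun k => (S k).1)) +
          5 * c * √(2 * Real.log (8 / δ) / K) := by
  by_cases hex : ∃ f, IsMinimizer (mapSpace H n) (risk D ℓ) f
  swap
  · refine ⟨Set.univ, MeasurableSet.univ, ?_, fun S _ fS fD _ hD => absurd ⟨fD, hD⟩ hex⟩
    rw [measure_univ, ENNReal.ofReal_le_one]
    linarith
  obtain ⟨f₀, hf₀F, hf₀⟩ := hex
  have : Countable G := hGc.to_subtype
  have : Nonempty G := hGne.to_subtype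
  choose! Ψ hΨm hΨ using hm
  -- the loss of `f`, modified to be measurable and bounded everywhere
  let φ : (X → Fin n → ℝ) → X × (Fin n → ℝ) → ℝ := fun f => Ω₀.indicator (Ψ f)
  have hφe : ∀ f ∈ mapSpace H n, ∀ p ∈ Ω₀, φ f p = ℓ p.2 (f p.1) := fun f hf p hp => by
    simp only [φ, Set.indicator_of_mem hp, hΨ f hf p hp]
  have hφm : ∀ f ∈ mapSpace H n, Measurable (φ f) := fun f hf => (hΨm f hf).indicator hΩm
  have hc0 : 0 ≤ c := by
    obtain ⟨p, hp⟩ := hΩ.exists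
    exact (h0 f₀ hf₀F p hp).trans (hc f₀ hf₀F p hp)
  have hφ0 : ∀ f ∈ mapSpace H n, ∀ p, 0 ≤ φ f p := fun f hf p => by
    by_cases hp : p ∈ Ω₀
    · rw [hφe f hf p hp]; exact h0 f hf p hp
    · simp [φ, hp]
  have hφc : ∀ f ∈ mapSpace H n, ∀ p, φ f p ≤ c := fun f hf p => by
    by_cases hp : p ∈ Ω₀
    · rw [hφe f hf p hp]; exact hc f hf p hp
    · simpa [φ, hp] using hc0
  have hφr : ∀ f ∈ mapSpace H n, ∫ p, φ f p ∂D = risk D ℓ f := fun f hf =>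
    integral_congr_ae (by filter_upwards [hΩ] with p hp using hφe f hf p hp)
  have htF : ∀ i : Fin n → G, tupleMap i ∈ mapSpace H n := tupleMap_mem hG.1
  obtain ⟨E, hEm, hEP, hE⟩ := exists_event_forall_sub_le D hK
    (ψ := fun i : Fin n → G => φ (tupleMap i)) (fun i => hφm _ (htF i)) (fun i => hφ0 _ (htF i))
    (fun i => hφc _ (htF i)) (hφm f₀ hf₀F) (hφ0 f₀ hf₀F) (hφc f₀ hf₀F)
    (η := δ / 4) (by linarith) (by linarith)
  have hsure : ∀ᵐ S ∂(Measure.pi fun _ : Fin K => D), ∀ k, S k ∈ Ω₀ :=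
    ae_all_iff.2 fun k => (Measure.quasiMeasurePreserving_eval (fun _ : Fin K => D) k).ae hΩ
  refine ⟨E ∩ {S | ∀ k, S k ∈ Ω₀}, ?_, ?_, ?_⟩
  · refine hEm.inter ?_
    have : {S : Fin K → X × (Fin n → ℝ) | ∀ k, S k ∈ Ω₀} = ⋂ k, (fun S => S k) ⁻¹' Ω₀ := by
      ext; simp
    rw [this]
    exact MeasurableSet.iInter fun k => measurable_pi_apply k hΩm
  · refine hEP.trans (measure_mono_ae ?_)
    filter_upwards [hsure] with S hS hSE using ⟨hSE, hS⟩
  rintro S ⟨hSE, hSΩ⟩ fS fD ⟨hfSF, hfS⟩ ⟨hfDF, hfD⟩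
  have hemp : ∀ f ∈ mapSpace H n, wavg (fun _ => 1) (fun k => φ f (S k)) = empRisk S ℓ f :=
    fun f hf => by simp [wavg, empRisk, fun k => hφe f hf (S k) (hSΩ k)]
  obtain ⟨i, hi⟩ := hG.exists_tupleMap hfSF
  have hℓlim : ∀ p ∈ Ω₀, Tendsto (fun m => ℓ p.2 (tupleMap (i m) p.1)) atTop
      (𝓝 (ℓ p.2 (fS p.1))) := fun p hp => hlim p hp fS hfSF _ (fun m => htF (i m)) (hi p.1)
  have hrisk : Tendsto (fun m => risk D ℓ (tupleMap (i m))) atTop (𝓝 (risk D ℓ fS)) := by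
    refine Tendsto.congr (fun m => hφr _ (htF (i m))) ?_
    refine tendsto_integral_of_dominated_convergence (fun _ => c)
      (fun m => (hφm _ (htF (i m))).aestronglyMeasurable) (integrable_const _)
      (fun m => Eventually.of_forall fun p => ?_) ?_
    · rw [Real.norm_of_nonneg (hφ0 _ (htF (i m)) p)]
      exact hφc _ (htF (i m)) p
    · filter_upwards [hΩ] with p hp
      exact (hℓlim p hp).congr fun m => (hφe _ (htF (i m)) p hp).symm
  have hempl : Tendsto (fun m => empRisk S ℓ (tupleMap (i m))) atTop (𝓝 (empRisk S ℓ fS)) := by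
    unfold empRisk
    exact (tendsto_finsetSum _ fun k _ => hℓlim (S k) (hSΩ k)).div_const _
  have hradS : radComplexity (fun (i : Fin n → G) k => φ (tupleMap i) (S k)) ≤
      ρ * rademacher H (fun k => (S k).1) := by
    simp only [fun (i : Fin n → G) k => hφe _ (htF i) (S k) (hSΩ k)]
    exact hrad S hSΩ
  have hK' : (0 : ℝ) < K := Nat.cast_pos.2 hK
  have htail : 4 * c * √(Real.log (1 / (δ / 4)) / (2 * K)) ≤
      5 * c * √(2 * Real.log (8 / δ) / K) := by
    have hlog : Real.log (1 / (δ / 4)) ≤ Real.log (8 / δ) := by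
      refine Real.log_le_log (by positivity) ?_
      rw [one_div_div]
      gcongr
      norm_num
    have hlog8 : 0 ≤ Real.log (8 / δ) := Real.log_nonneg (by rw [le_div_iff₀ hδ0]; linarith)
    refine mul_le_mul (by linarith) (Real.sqrt_le_sqrt ?_) (Real.sqrt_nonneg _) (by linarith)
    rw [div_le_div_iff₀ (by positivity) hK']
    nlinarith [mul_le_mul_of_nonneg_right hlog hK'.le, mul_nonneg hlog8 hK'.le]
  have hlimit : risk D ℓ fS - empRisk S ℓ fS + (empRisk S ℓ f₀ - risk D ℓ f₀) ≤
      2 * (ρ * rademacher H (fun k => (S k).1)) + 5 * c * √(2 * Real.log (8 / δ) / K) := by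
    refine le_of_tendsto ((hrisk.sub hempl).add_const _) (Eventually.of_forall fun m => ?_)
    have := hE S hSE (i m)
    rw [hφr _ (htF (i m)), hφr _ hf₀F, hemp _ (htF (i m)), hemp _ hf₀F] at this
    linarith
  have hmin := hfS f₀ hf₀F
  have heq := hf₀ fD hfDF
  linarith

/-! ### The almost sure set on which all the losses are bounded and Lipschitz -/

/-- The pairs (image, annotation map) at which the assumptions on the annotation map and on the
values of the hypotheses hold for every map of the class at once. -/
def regularSet {X : Type*} (H : Set (X → ℝ)) (n : ℕ) (B : ℝ) : Set (X × (Fin n → ℝ)) :=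
  {p | (∀ i, 0 ≤ p.2 i) ∧ 1 ≤ l1 p.2 ∧
    ∀ f ∈ mapSpace H n, 1 ≤ l1 (f p.1) ∧ lossC p.2 (f p.1) ≤ B}

/-- The defining conditions are closed, so tuples from a dense subclass detect them. -/
lemma regularSet_eq {X : Type*} {G H : Set (X → ℝ)} (hG : IsPointwiseDense G H) (n : ℕ) (B : ℝ) :
    regularSet H n B = {p | (∀ i, 0 ≤ p.2 i) ∧ 1 ≤ l1 p.2 ∧
      ∀ i : Fin n → G, 1 ≤ l1 (tupleMap i p.1) ∧ lossC p.2 (tupleMap i p.1) ≤ B} := by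
  ext p
  constructor
  · rintro ⟨h0, h1, h⟩
    exact ⟨h0, h1, fun i => h _ (tupleMap_mem hG.1 i)⟩
  · rintro ⟨h0, h1, h⟩
    refine ⟨h0, h1, fun f hf => ?_⟩
    obtain ⟨i, hi⟩ := hG.exists_tupleMap hf
    have hl := (continuous_l1.tendsto _).comp (hi p.1)
    exact ⟨ge_of_tendsto hl (Eventually.of_forall fun m => (h (i m)).1),
      le_of_tendsto (hl.const_sub (l1 p.2)).abs (Eventually.of_forall fun m => (h (i m)).2)⟩

lemma measurableSet_regularSet {X : Type*} [MeasurableSpace X] {G H : Set (X → ℝ)}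
    (hHmeas : ∀ h ∈ H, Measurable h) (hG : IsPointwiseDense G H) (hGc : G.Countable) (n : ℕ)
    (B : ℝ) : MeasurableSet (regularSet H n B) := by
  have : Countable G := hGc.to_subtype
  rw [regularSet_eq hG]
  have hl : ∀ i : Fin n → G, Measurable fun p : X × (Fin n → ℝ) => l1 (tupleMap i p.1) := fun i =>
    measurable_l1.comp
      ((measurable_of_mem_mapSpace hHmeas (tupleMap_mem hG.1 i)).comp measurable_fst)
  have hl2 : Measurable fun p : X × (Fin n → ℝ) => l1 p.2 := measurable_l1.comp measurable_snd
  refine measurableSet_setOfPred.2 ?_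
  refine Measurable.and (Measurable.forall fun i => ?_) (Measurable.and ?_
    (Measurable.forall fun i => Measurable.and ?_ ?_))
  · exact measurableSet_setOfPred.1
      (measurableSet_le measurable_const ((measurable_pi_apply i).comp measurable_snd))
  · exact measurableSet_setOfPred.1 (measurableSet_le measurable_const hl2)
  · exact measurableSet_setOfPred.1 (measurableSet_le measurable_const (hl i))
  · exact measurableSet_setOfPred.1 (measurableSet_le (hl2.sub (hl i)).abs measurable_const)

lemma ae_mem_regularSet {X : Type*} [MeasurableSpace X] {n : ℕ} {D : Measure (X × (Fin n → ℝ))}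
    {G H : Set (X → ℝ)} (hG : IsPointwiseDense G H) (hGc : G.Countable) {B : ℝ}
    (hz0 : ∀ᵐ p ∂D, ∀ i, 0 ≤ p.2 i) (hz1 : ∀ᵐ p ∂D, 1 ≤ l1 p.2)
    (hf1 : ∀ f ∈ mapSpace H n, ∀ᵐ p ∂D, 1 ≤ l1 (f p.1))
    (hB : ∀ f ∈ mapSpace H n, ∀ᵐ p ∂D, lossC p.2 (f p.1) ≤ B) :
    ∀ᵐ p ∂D, p ∈ regularSet H n B := by
  have : Countable G := hGc.to_subtype
  rw [regularSet_eq hG]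
  have h1 := ae_all_iff.2 fun i : Fin n → G => hf1 _ (tupleMap_mem hG.1 i)
  have h2 := ae_all_iff.2 fun i : Fin n → G => hB _ (tupleMap_mem hG.1 i)
  filter_upwards [hz0, hz1, h1, h2] with p a b c d using ⟨a, b, fun i => ⟨c i, d i⟩⟩

/-- The bound `1 ≤ ‖f(I)‖₁` for the map with all coordinates equal to `h` bounds `h` from below. -/
lemma one_div_le_of_mem_regularSet {X : Type*} {H : Set (X → ℝ)}
    (hHnonneg : ∀ h ∈ H, ∀ x, 0 ≤ h x) {n : ℕ} (hn : 0 < n) {B : ℝ} {p : X × (Fin n → ℝ)}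
    (hp : p ∈ regularSet H n B) {h : X → ℝ} (hh : h ∈ H) : 1 / (n : ℝ) ≤ h p.1 := by
  have h1 := (hp.2.2 (fun x _ => h x) fun _ => hh).1
  rw [l1_eq_sum fun _ => hHnonneg h hh _] at h1
  rw [div_le_iff₀ (Nat.cast_pos.2 hn)]
  simpa [mul_comm] using h1

lemma le_add_of_mem_regularSet {X : Type*} {H : Set (X → ℝ)} {n : ℕ} (hn : 0 < n) {B : ℝ}
    {p : X × (Fin n → ℝ)} (hp : p ∈ regularSet H n B) {h : X → ℝ} (hh : h ∈ H) :
    h p.1 ≤ l1 p.2 + B := by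
  have h1 := (abs_le.1 (hp.2.2 (fun x _ => h x) fun _ => hh).2).1
  have h2 : |h p.1| ≤ l1 (fun _ : Fin n => h p.1) :=
    Finset.single_le_sum (f := fun _ : Fin n => |h p.1|) (fun _ _ => abs_nonneg _)
      (Finset.mem_univ (⟨0, hn⟩ : Fin n))
  linarith [le_abs_self (h p.1)]

/-- On the regular set the total variation distance of normalized predictions is
`n / 2`-Lipschitz in the predictions, for the supremum norm. -/
lemma exists_half_l1_le_of_mem_regularSet {X : Type*} {H : Set (X → ℝ)}
    (hHnonneg : ∀ h ∈ H, ∀ x, 0 ≤ h x) {n : ℕ} (hn : 0 < n) {B : ℝ} {p : X × (Fin n → ℝ)}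
    (hp : p ∈ regularSet H n B) {f g : X → Fin n → ℝ} (hf : f ∈ mapSpace H n)
    (hg : g ∈ mapSpace H n) :
    ∃ j, (1 / 2) * l1 (normalize (f p.1) - normalize (g p.1)) ≤ n / 2 * |f p.1 j - g p.1 j| := by
  have : Nonempty (Fin n) := ⟨⟨0, hn⟩⟩
  obtain ⟨j, hj⟩ := Finite.exists_max fun j => |f p.1 j - g p.1 j|
  exact ⟨j, half_l1_normalize_sub_le hn
    (fun i => one_div_le_of_mem_regularSet hHnonneg hn hp (hf i))
    (fun i => one_div_le_of_mem_regularSet hHnonneg hn hp (hg i)) hj⟩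

lemma exists_bound_of_mem_regularSet {X : Type*} {H : Set (X → ℝ)}
    (hHnonneg : ∀ h ∈ H, ∀ x, 0 ≤ h x) {n K : ℕ} (hn : 0 < n) {B : ℝ}
    {S : Fin K → X × (Fin n → ℝ)} (hS : ∀ k, S k ∈ regularSet H n B) :
    ∃ U, ∀ h : H, ∀ k, |(h : X → ℝ) (S k).1| ≤ U := by
  refine ⟨∑ k, |l1 (S k).2 + B|, fun h k => ?_⟩
  rw [abs_of_nonneg (hHnonneg _ h.2 _)]
  exact ((le_add_of_mem_regularSet hn (hS k) h.2).trans (le_abs_self _)).trans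
    (Finset.single_le_sum (f := fun k => |l1 (S k).2 + B|) (fun _ _ => abs_nonneg _)
      (Finset.mem_univ k))

/-- Continuity along a sequence of predictions of a function that is Lipschitz for the total
variation distance of the normalized predictions. -/
lemma tendsto_of_sub_le_half_l1 {n : ℕ} {F : (Fin n → ℝ) → ℝ} {L : ℝ} {v : ℕ → Fin n → ℝ}
    {w : Fin n → ℝ} (hv : Tendsto v atTop (𝓝 w)) (hw : 1 ≤ l1 w)
    (h1 : ∀ m, F (v m) - F w ≤ L * ((1 / 2) * l1 (normalize (v m) - normalize w)))
    (h2 : ∀ m, F w - F (v m) ≤ L * ((1 / 2) * l1 (normalize w - normalize (v m)))) :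
    Tendsto (fun m => F (v m)) atTop (𝓝 (F w)) := by
  refine tendsto_iff_dist_tendsto_zero.2 (squeeze_zero (fun _ => dist_nonneg) (fun m => ?_)
    (by simpa only [mul_zero] using (tendsto_half_l1_normalize_sub hv hw).const_mul L))
  have := h2 m
  rw [l1_sub_comm] at this
  rw [Real.dist_eq, abs_le]
  exact ⟨by linarith, h1 m⟩

lemma measure_inter_ge {Ω : Type*} [MeasurableSpace Ω] {P : Measure Ω} [IsProbabilityMeasure P]
    {E F : Set Ω} (hF : MeasurableSet F) {a b : ℝ}
    (ha : ENNReal.ofReal (1 - a) ≤ P E) (hb : ENNReal.ofReal (1 - b) ≤ P F) :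
    ENNReal.ofReal (1 - (a + b)) ≤ P (E ∩ F) := by
  have ha' : 1 - a ≤ P.real E := (ENNReal.ofReal_le_iff_le_toReal (measure_ne_top P E)).1 ha
  have hb' : 1 - b ≤ P.real F := (ENNReal.ofReal_le_iff_le_toReal (measure_ne_top P F)).1 hb
  have h := measureReal_union_add_inter (μ := P) (s := E) hF
  have h1 : P.real (E ∪ F) ≤ 1 := measureReal_le_one
  refine ENNReal.ofReal_le_of_le_toReal ?_
  change _ ≤ P.real (E ∩ F)
  linarith

/-! ### The four excess risk bounds -/

lemma abs_le_of_nonneg_of_le {a c : ℝ} (h0 : 0 ≤ a) (hc : a ≤ c) : |a| ≤ c := by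
  rwa [abs_of_nonneg h0]

end CrowdCounting

end

open CrowdCounting

theorem theorem2 {X : Type*} [MeasurableSpace X] {n K : ℕ} (hK : 0 < K)
    (D : Measure (X × (Fin n → ℝ))) [IsProbabilityMeasure D]
    -- the hypothesis space: measurable functions from images to nonnegative reals
    (H : Set (X → ℝ)) (hHmeas : ∀ h ∈ H, Measurable h) (hHnonneg : ∀ h ∈ H, ∀ x, 0 ≤ h x)
    (hHsep : CrowdCounting.PointwiseSeparable H)
    -- the annotation maps are nonnegative
    (hz0 : ∀ᵐ p ∂D, ∀ i, 0 ≤ p.2 i)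
    (hz1 : ∀ᵐ p ∂D, 1 ≤ CrowdCounting.l1 p.2)
    (hf1 : ∀ f ∈ CrowdCounting.mapSpace H n, ∀ᵐ p ∂D, 1 ≤ CrowdCounting.l1 (f p.1))
    (B : ℝ)
    (hB : ∀ f ∈ CrowdCounting.mapSpace H n, ∀ᵐ p ∂D, CrowdCounting.lossC p.2 (f p.1) ≤ B)
    -- the transport cost matrix and the weights of the overall loss
    (C : Fin n → Fin n → ℝ) (hC : ∀ i j, 0 ≤ C i j)
    (lam₁ lam₂ : ℝ) (hlam₁ : 0 ≤ lam₁) (hlam₂ : 0 ≤ lam₂)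
    (δ : ℝ) (hδ0 : 0 < δ) (hδ1 : δ < 1) :
    -- with probability at least `1 - δ` over the i.i.d. sample `S` of size `K`
    ∃ E : Set (Fin K → X × (Fin n → ℝ)), MeasurableSet E ∧
      ENNReal.ofReal (1 - δ) ≤ Measure.pi (fun _ : Fin K => D) E ∧
      ∀ S ∈ E,
        -- (a) the counting loss
        (∀ fS fD : X → Fin n → ℝ,
          CrowdCounting.IsMinimizer (CrowdCounting.mapSpace H n)
            (CrowdCounting.empRisk S CrowdCounting.lossC) fS →
          CrowdCounting.IsMinimizer (CrowdCounting.mapSpace H n)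
            (CrowdCounting.risk D CrowdCounting.lossC) fD →
          CrowdCounting.risk D CrowdCounting.lossC fS ≤
            CrowdCounting.risk D CrowdCounting.lossC fD
              + 2 * n * CrowdCounting.rademacher H (fun k => (S k).1)
              + 5 * B * Real.sqrt (2 * Real.log (8 / δ) / K)) ∧
        -- (b) the optimal transport loss
        (∀ fS fD : X → Fin n → ℝ,
          CrowdCounting.IsMinimizer (CrowdCounting.mapSpace H n)
            (CrowdCounting.empRisk S (CrowdCounting.lossOT C)) fS →
          CrowdCounting.IsMinimizer (CrowdCounting.mapSpace H n)
            (CrowdCounting.risk D (CrowdCounting.lossOT C)) fD →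
          CrowdCounting.risk D (CrowdCounting.lossOT C) fS ≤
            CrowdCounting.risk D (CrowdCounting.lossOT C) fD
              + 4 * CrowdCounting.maxCost C * (n : ℝ) ^ 2
                  * CrowdCounting.rademacher H (fun k => (S k).1)
              + 5 * CrowdCounting.maxCost C * Real.sqrt (2 * Real.log (8 / δ) / K)) ∧
        -- (c) the total variation loss
        (∀ fS fD : X → Fin n → ℝ,
          CrowdCounting.IsMinimizer (CrowdCounting.mapSpace H n)
            (CrowdCounting.empRisk S CrowdCounting.lossTV) fS →
          CrowdCounting.IsMinimizer (CrowdCounting.mapSpace H n)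
            (CrowdCounting.risk D CrowdCounting.lossTV) fD →
          CrowdCounting.risk D CrowdCounting.lossTV fS ≤
            CrowdCounting.risk D CrowdCounting.lossTV fD
              + (n : ℝ) ^ 2 * CrowdCounting.rademacher H (fun k => (S k).1)
              + 5 * Real.sqrt (2 * Real.log (8 / δ) / K)) ∧
        -- (d) the overall loss (if the maximum count `N` is infinite, there is nothing to say)
        (∀ N : ℝ, CrowdCounting.IsMaxCount D N → ∀ fS fD : X → Fin n → ℝ,
          CrowdCounting.IsMinimizer (CrowdCounting.mapSpace H n)
            (CrowdCounting.empRisk S (CrowdCounting.lossAll C lam₁ lam₂)) fS →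
          CrowdCounting.IsMinimizer (CrowdCounting.mapSpace H n)
            (CrowdCounting.risk D (CrowdCounting.lossAll C lam₁ lam₂)) fD →
          CrowdCounting.risk D (CrowdCounting.lossAll C lam₁ lam₂) fS ≤
            CrowdCounting.risk D (CrowdCounting.lossAll C lam₁ lam₂) fD
              + (2 * n + 4 * lam₁ * CrowdCounting.maxCost C * (n : ℝ) ^ 2
                  + lam₂ * N * (n : ℝ) ^ 2) * CrowdCounting.rademacher H (fun k => (S k).1)
              + 5 * (B + lam₁ * CrowdCounting.maxCost C + lam₂ * N)
                  * Real.sqrt (2 * Real.log (8 / δ) / K)) := by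
  rcases Nat.eq_zero_or_pos n with rfl | hn
  · obtain ⟨p, hp⟩ := hz1.exists
    exact absurd hp (by simp [l1])
  rcases H.eq_empty_or_nonempty with rfl | ⟨h₁, hh₁⟩
  · have hno : ∀ {R : (X → Fin n → ℝ) → ℝ} {f : X → Fin n → ℝ},
        ¬ IsMinimizer (mapSpace (∅ : Set (X → ℝ)) n) R f := fun hf => hf.1 ⟨0, hn⟩
    refine ⟨Set.univ, MeasurableSet.univ, ?_, fun S _ => ⟨fun _ _ hf => absurd hf hno,
      fun _ _ hf => absurd hf hno, fun _ _ hf => absurd hf hno, fun _ _ _ _ hf => absurd hf hno⟩⟩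
    rw [measure_univ, ENNReal.ofReal_le_one]
    linarith
  obtain ⟨G, hGH, hGc, hGd⟩ := hHsep
  have hG : IsPointwiseDense G H := ⟨hGH, hGd⟩
  have hGne : G.Nonempty := by
    obtain ⟨g, hg, -⟩ := hGd h₁ hh₁
    exact ⟨g 0, hg 0⟩
  have : Nonempty G := hGne.to_subtype
  set Ω₀ := regularSet H n B
  have hΩm : MeasurableSet Ω₀ := measurableSet_regularSet hHmeas hG hGc n B
  have hΩ : ∀ᵐ p ∂D, p ∈ Ω₀ := ae_mem_regularSet hG hGc hz0 hz1 hf1 hB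
  have hnn : ∀ f ∈ mapSpace H n, ∀ x i, 0 ≤ f x i := fun f hf x i => hHnonneg _ (hf i) x
  have hfm : ∀ f ∈ mapSpace H n, Measurable fun p : X × (Fin n → ℝ) => f p.1 := fun f hf =>
    (measurable_of_mem_mapSpace hHmeas hf).comp measurable_fst
  have hCmax := maxCost_nonneg hC
  have htF : ∀ i : Fin n → G, tupleMap i ∈ mapSpace H n := tupleMap_mem hGH
  have bC : ∀ f ∈ mapSpace H n, ∀ p ∈ Ω₀, lossC p.2 (f p.1) ≤ B := fun f hf p hp => (hp.2.2 f hf).2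
  have bOT : ∀ f ∈ mapSpace H n, ∀ p ∈ Ω₀, lossOT C p.2 (f p.1) ≤ maxCost C := fun f hf p hp =>
    lossOT_le_maxCost hC hp.1 hp.2.1 (hnn f hf _) (hp.2.2 f hf).1
  have bTV : ∀ f ∈ mapSpace H n, ∀ p ∈ Ω₀, lossTV p.2 (f p.1) ≤ 1 := fun f hf p hp =>
    lossTV_le_one hp.1 hp.2.1 (hnn f hf _) (hp.2.2 f hf).1
  have mC : ∀ f ∈ mapSpace H n, Measurable fun p : X × (Fin n → ℝ) => lossC p.2 (f p.1) :=
    fun f hf => ((measurable_l1.comp measurable_snd).sub (measurable_l1.comp (hfm f hf))).abs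
  have mTV : ∀ f ∈ mapSpace H n, Measurable fun p : X × (Fin n → ℝ) => lossTV p.2 (f p.1) :=
    fun f hf => (measurable_l1.comp ((measurable_normalize.comp measurable_snd).sub
      (measurable_normalize.comp (hfm f hf)))).const_mul _
  have mOT : ∀ f ∈ mapSpace H n, ∃ ψ : X × (Fin n → ℝ) → ℝ, Measurable ψ ∧
      ∀ p ∈ Ω₀, ψ p = lossOT C p.2 (f p.1) := fun f hf => by
    obtain ⟨W, hW, hWe⟩ := exists_measurable_eq_otCost hC
    exact ⟨fun p => W (normalize p.2, normalize (f p.1)), hW.comp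
      ((measurable_normalize.comp measurable_snd).prodMk (measurable_normalize.comp (hfm f hf))),
      fun p hp => hWe _ (normalize_mem_stdSimplex hp.1 hp.2.1) _
        (normalize_mem_stdSimplex (hnn f hf _) (hp.2.2 f hf).1)⟩
  have lC : ∀ f ∈ mapSpace H n, ∀ g ∈ mapSpace H n, ∀ p : X × (Fin n → ℝ),
      lossC p.2 (f p.1) - lossC p.2 (g p.1) ≤ |∑ j, f p.1 j - ∑ j, g p.1 j| :=
    fun f hf g hg p => lossC_sub_le _ (hnn f hf _) (hnn g hg _)
  have lOT : ∀ f ∈ mapSpace H n, ∀ g ∈ mapSpace H n, ∀ p ∈ Ω₀,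
      lossOT C p.2 (f p.1) - lossOT C p.2 (g p.1) ≤
        maxCost C * ((1 / 2) * l1 (normalize (f p.1) - normalize (g p.1))) :=
    fun f hf g hg p hp => lossOT_sub_le hC hp.1 hp.2.1 (hnn f hf _) (hp.2.2 f hf).1 (hnn g hg _)
      (hp.2.2 g hg).1
  have cC : ∀ p ∈ Ω₀, ∀ f ∈ mapSpace H n, ∀ g : ℕ → X → Fin n → ℝ, (∀ m, g m ∈ mapSpace H n) →
      Tendsto (fun m => g m p.1) atTop (𝓝 (f p.1)) →
        Tendsto (fun m => lossC p.2 (g m p.1)) atTop (𝓝 (lossC p.2 (f p.1))) :=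
    fun p _ f _ g _ hgf => (((continuous_l1.tendsto _).comp hgf).const_sub (l1 p.2)).abs
  have cOT : ∀ p ∈ Ω₀, ∀ f ∈ mapSpace H n, ∀ g : ℕ → X → Fin n → ℝ, (∀ m, g m ∈ mapSpace H n) →
      Tendsto (fun m => g m p.1) atTop (𝓝 (f p.1)) →
        Tendsto (fun m => lossOT C p.2 (g m p.1)) atTop (𝓝 (lossOT C p.2 (f p.1))) :=
    fun p hp f hf g hg hgf => tendsto_of_sub_le_half_l1 hgf (hp.2.2 f hf).1
      (fun m => lOT _ (hg m) f hf p hp) (fun m => lOT f hf _ (hg m) p hp)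
  have cTV : ∀ p ∈ Ω₀, ∀ f ∈ mapSpace H n, ∀ g : ℕ → X → Fin n → ℝ, (∀ m, g m ∈ mapSpace H n) →
      Tendsto (fun m => g m p.1) atTop (𝓝 (f p.1)) →
        Tendsto (fun m => lossTV p.2 (g m p.1)) atTop (𝓝 (lossTV p.2 (f p.1))) :=
    fun p hp f hf g hg hgf => tendsto_of_sub_le_half_l1 (F := lossTV p.2) (L := 1) hgf
      (hp.2.2 f hf).1 (fun m => by rw [one_mul]; exact lossTV_sub_le _ _ _)
      (fun m => by rw [one_mul]; exact lossTV_sub_le _ _ _)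
  let v : (Fin n → G) → Fin n → H := fun i j => Set.inclusion hGH (i j)
  have rC : ∀ S : Fin K → X × (Fin n → ℝ), (∀ k, S k ∈ Ω₀) →
      radComplexity (fun (i : Fin n → G) k => lossC (S k).2 (tupleMap i (S k).1)) ≤
        n * rademacher H (fun k => (S k).1) := fun S hS => by
    obtain ⟨U, hU⟩ := exists_bound_of_mem_regularSet hHnonneg hn hS
    exact radComplexity_le_of_sum_lipschitz hK hU v (c := B)
      (fun i k => abs_le_of_nonneg_of_le (lossC_nonneg _ _) (bC _ (htF i) _ (hS k)))
      fun k i i' => lC _ (htF i) _ (htF i') (S k)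
  have rSup : ∀ S : Fin K → X × (Fin n → ℝ), (∀ k, S k ∈ Ω₀) →
      ∀ (F : (Fin n → ℝ) → (Fin n → ℝ) → ℝ) (b L : ℝ), 0 ≤ L →
      (∀ f ∈ mapSpace H n, ∀ k, |F (S k).2 (f (S k).1)| ≤ b) →
      (∀ f ∈ mapSpace H n, ∀ g ∈ mapSpace H n, ∀ k, F (S k).2 (f (S k).1) - F (S k).2 (g (S k).1) ≤
        L * ((1 / 2) * l1 (normalize (f (S k).1) - normalize (g (S k).1)))) →
      radComplexity (fun (i : Fin n → G) k => F (S k).2 (tupleMap i (S k).1)) ≤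
        L * (n / 2) * n * rademacher H (fun k => (S k).1) := fun S hS F b L hL hb hF => by
    obtain ⟨U, hU⟩ := exists_bound_of_mem_regularSet hHnonneg hn hS
    refine radComplexity_le_of_sup_lipschitz hK hU v (c := b) (fun i k => hb _ (htF i) k)
      (by positivity) fun k i i' => ?_
    obtain ⟨j, hj⟩ := exists_half_l1_le_of_mem_regularSet hHnonneg hn (hS k) (htF i) (htF i')
    refine ⟨j, (hF _ (htF i) _ (htF i') k).trans ?_⟩
    rw [mul_assoc]
    exact mul_le_mul_of_nonneg_left hj hL
  obtain ⟨E₁, hE₁m, hE₁P, hE₁⟩ := exists_event_risk_le hK D hG hGc hGne hΩm hΩ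
    (fun f _ p _ => lossC_nonneg p.2 (f p.1)) bC (fun f hf => ⟨_, mC f hf, fun _ _ => rfl⟩) cC rC
    hδ0 hδ1
  -- `maxCost C` is already a Lipschitz constant of the transport loss for the total variation
  -- distance; `4 * maxCost C` produces the coefficient `4 * maxCost C * n ^ 2`
  obtain ⟨E₂, hE₂m, hE₂P, hE₂⟩ := exists_event_risk_le hK D hG hGc hGne hΩm hΩ
    (ρ := 4 * maxCost C * (n / 2) * n)
    (fun f _ p _ => lossOT_nonneg hC p.2 (f p.1)) bOT mOT cOT
    (fun S hS => rSup S hS (lossOT C) (maxCost C) (4 * maxCost C) (by positivity)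
      (fun f hf k => abs_le_of_nonneg_of_le (lossOT_nonneg hC _ _) (bOT f hf _ (hS k)))
      (fun f hf g hg k => (lOT f hf g hg _ (hS k)).trans (mul_le_mul_of_nonneg_right (by linarith)
        (mul_nonneg (by norm_num) (l1_nonneg _)))))
    hδ0 hδ1
  obtain ⟨E₃, hE₃m, hE₃P, hE₃⟩ := exists_event_risk_le hK D hG hGc hGne hΩm hΩ
    (ρ := 1 * (n / 2) * n)
    (fun f _ p _ => lossTV_nonneg p.2 (f p.1)) bTV (fun f hf => ⟨_, mTV f hf, fun _ _ => rfl⟩) cTV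
    (fun S hS => rSup S hS lossTV 1 1 zero_le_one
      (fun f hf k => abs_le_of_nonneg_of_le (lossTV_nonneg _ _) (bTV f hf _ (hS k)))
      (fun f hf g hg k => by rw [one_mul]; exact lossTV_sub_le _ _ _))
    hδ0 hδ1
  obtain ⟨E₄, hE₄m, hE₄P, hE₄⟩ : ∃ E : Set (Fin K → X × (Fin n → ℝ)), MeasurableSet E ∧
      ENNReal.ofReal (1 - δ / 4) ≤ Measure.pi (fun _ : Fin K => D) E ∧
      ∀ S ∈ E, ∀ N : ℝ, IsMaxCount D N → ∀ fS fD : X → Fin n → ℝ,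
        IsMinimizer (mapSpace H n) (empRisk S (lossAll C lam₁ lam₂)) fS →
        IsMinimizer (mapSpace H n) (risk D (lossAll C lam₁ lam₂)) fD →
        risk D (lossAll C lam₁ lam₂) fS ≤ risk D (lossAll C lam₁ lam₂) fD +
          2 * ((n + (lam₁ * (4 * maxCost C) + lam₂ * N) * (n / 2) * n) *
            rademacher H (fun k => (S k).1)) +
          5 * (B + (lam₁ * maxCost C + lam₂ * N)) * √(2 * Real.log (8 / δ) / K) := by
    by_cases hN : ∃ N, IsMaxCount D N
    swap
    · refine ⟨Set.univ, MeasurableSet.univ, ?_, fun S _ N h => absurd ⟨N, h⟩ hN⟩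
      rw [measure_univ, ENNReal.ofReal_le_one]
      linarith
    obtain ⟨N, hN⟩ := hN
    have hNae : ∀ᵐ p ∂D, l1 p.2 ≤ N := hN.1
    have hN0 : 0 ≤ N := by
      obtain ⟨p, hp⟩ := hNae.exists
      exact (l1_nonneg _).trans hp
    -- the part of the overall loss that depends on the normalized predictions only
    let F : (Fin n → ℝ) → (Fin n → ℝ) → ℝ := fun z x =>
      lam₁ * lossOT C z x + lam₂ * l1 z * lossTV z x
    have hall : ∀ z x, lossAll C lam₁ lam₂ z x = lossC z x + F z x := fun z x => by
      simp only [lossAll, F]; ring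
    have hF0 : ∀ z x, 0 ≤ F z x := fun z x => add_nonneg (mul_nonneg hlam₁ (lossOT_nonneg hC _ _))
      (mul_nonneg (mul_nonneg hlam₂ (l1_nonneg _)) (lossTV_nonneg _ _))
    have bF : ∀ f ∈ mapSpace H n, ∀ p ∈ Ω₀ ∩ {p | l1 p.2 ≤ N},
        F p.2 (f p.1) ≤ lam₁ * maxCost C + lam₂ * N := fun f hf p hp =>
      add_le_add (mul_le_mul_of_nonneg_left (bOT f hf p hp.1) hlam₁)
        ((mul_le_of_le_one_right (mul_nonneg hlam₂ (l1_nonneg _)) (bTV f hf p hp.1)).trans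
          (mul_le_mul_of_nonneg_left hp.2 hlam₂))
    have lF : ∀ f ∈ mapSpace H n, ∀ g ∈ mapSpace H n, ∀ p ∈ Ω₀ ∩ {p | l1 p.2 ≤ N},
        F p.2 (f p.1) - F p.2 (g p.1) ≤ (lam₁ * (4 * maxCost C) + lam₂ * N) *
          ((1 / 2) * l1 (normalize (f p.1) - normalize (g p.1))) := fun f hf g hg p hp => by
      have hd0 : 0 ≤ (1 / 2) * l1 (normalize (f p.1) - normalize (g p.1)) :=
        mul_nonneg (by norm_num) (l1_nonneg _)
      have e1 := mul_le_mul_of_nonneg_left ((lOT f hf g hg p hp.1).trans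
        (mul_le_mul_of_nonneg_right (by linarith : maxCost C ≤ 4 * maxCost C) hd0)) hlam₁
      have e2 := mul_le_mul_of_nonneg_left (lossTV_sub_le p.2 (f p.1) (g p.1))
        (mul_nonneg hlam₂ (l1_nonneg p.2))
      have e3 := mul_le_mul_of_nonneg_right (mul_le_mul_of_nonneg_left hp.2 hlam₂) hd0
      simp only [F]
      linarith
    have hm1 : Measurable fun p : X × (Fin n → ℝ) => l1 p.2 := measurable_l1.comp measurable_snd
    obtain ⟨E, hEm, hEP, hE⟩ := exists_event_risk_le hK D hG hGc hGne
      (Ω₀ := Ω₀ ∩ {p | l1 p.2 ≤ N}) (ℓ := lossAll C lam₁ lam₂)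
      (c := B + (lam₁ * maxCost C + lam₂ * N))
      (ρ := n + (lam₁ * (4 * maxCost C) + lam₂ * N) * (n / 2) * n)
      (hΩm.inter (measurableSet_le hm1 measurable_const))
      (by filter_upwards [hΩ, hNae] with p h1 h2 using ⟨h1, h2⟩)
      (fun f hf p hp => by rw [hall]; exact add_nonneg (lossC_nonneg _ _) (hF0 _ _))
      (fun f hf p hp => by rw [hall]; exact add_le_add (bC f hf p hp.1) (bF f hf p hp))
      (fun f hf => by
        obtain ⟨ψ, hψ, hψe⟩ := mOT f hf
        refine ⟨fun p => lossC p.2 (f p.1) + lam₁ * ψ p + lam₂ * l1 p.2 * lossTV p.2 (f p.1),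
          ((mC f hf).add (hψ.const_mul _)).add ((hm1.const_mul _).mul (mTV f hf)),
          fun p hp => ?_⟩
        simp only [hψe p hp.1, lossAll])
      (fun p hp f hf g hg hgf => ((cC p hp.1 f hf g hg hgf).add
        ((cOT p hp.1 f hf g hg hgf).const_mul _)).add ((cTV p hp.1 f hf g hg hgf).const_mul _))
      (fun S hS => by
        simp only [hall]
        refine (radComplexity_add_le hK (c := B) (c' := lam₁ * maxCost C + lam₂ * N)
          (fun i k => abs_le_of_nonneg_of_le (lossC_nonneg _ _) (bC _ (htF i) _ (hS k).1))
          (fun i k => abs_le_of_nonneg_of_le (hF0 _ _) (bF _ (htF i) _ (hS k)))).trans ?_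
        rw [add_mul]
        exact add_le_add (rC S fun k => (hS k).1) (rSup S (fun k => (hS k).1) F _ _
          (by positivity) (fun f hf k => abs_le_of_nonneg_of_le (hF0 _ _) (bF f hf _ (hS k)))
          fun f hf g hg k => lF f hf g hg _ (hS k)))
      hδ0 hδ1
    refine ⟨E, hEm, hEP, fun S hS N' hN' => ?_⟩
    rw [hN'.unique hN]
    exact hE S hS
  refine ⟨(E₁ ∩ E₂) ∩ (E₃ ∩ E₄), (hE₁m.inter hE₂m).inter (hE₃m.inter hE₄m), ?_, ?_⟩
  · have h := measure_inter_ge (hE₃m.inter hE₄m) (measure_inter_ge hE₂m hE₁P hE₂P)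
      (measure_inter_ge hE₄m hE₃P hE₄P)
    rwa [show δ / 4 + δ / 4 + (δ / 4 + δ / 4) = δ by ring] at h
  rintro S ⟨⟨hS₁, hS₂⟩, hS₃, hS₄⟩
  refine ⟨fun fS fD hS hD => ?_, fun fS fD hS hD => ?_, fun fS fD hS hD => ?_,
    fun N hN fS fD hS hD => ?_⟩
  · exact (hE₁ S hS₁ fS fD hS hD).trans_eq (by ring)
  · exact (hE₂ S hS₂ fS fD hS hD).trans_eq (by ring)
  · exact (hE₃ S hS₃ fS fD hS hD).trans_eq (by ring)
  · exact (hE₄ S hS₄ N hN fS fD hS hD).trans_eq (by ring)
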